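/- \textbf{Proposition (Availability of transfer certificates).} \emph{Setting.} FastPay is run by $3f+1$ authorities, at most $f$ of which are Byzantine (they may behave arbitrarily), the others being honest; a \emph{quorum} is any set of at least $2f+1$ authorities. Signatures cannot be forged. The network is asynchronous: messages may be delayed, reordered and repeated, but every message sent to or by an honest authority, or between shards of one, is eventually delivered. A \emph{transfer order} $O$ has a sender (a FastPay account), a recipient (a FastPay account or an address of the Primary ledger), an amount in $\mathbb N$, a sequence number in $\mathbb N$, optional data, and is signed by its sender. A (valid) \emph{certificate} $C$ of $O=\mathrm{value}(C)$ consists of $O$ and the signatures of $O$ by a quorum; the fields of $C$ are those of $O$. A chain state $\sigma$ is the list of the funding transactions executed so far on the Primary, each with a recipient account and an amount and numbered $1,2,\dots$; $\mathrm{funding}^x(\sigma)$ is the sum of the amounts of those with recipient $x$; the Primary issues for each of them a \emph{synchronization order}. Each honest authority $\alpha$ keeps the index $\mathrm{last}(\alpha)$ of the last transaction it took into account (initially $0$) and, for each account $y$ in use, an integer $\mathrm{balance}^y(\alpha)$ (initially $0$, possibly negative), $\mathrm{next}^y(\alpha)\in\mathbb N$ (initially $0$), at most one pending transfer order, and the list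 of confirmed certificates from $y$. It handles authentic messages as follows. \begin{itemize} \item Synchronization order: if its index is $\mathrm{last}(\alpha)+1$, then $\alpha$ increments $\mathrm{last}(\alpha)$ and adds the amount to the balance of the recipient (creating the account if needed); otherwise nothing happens. \item Transfer order $O$ from $y$, where $y$ is in use: if $O$ is already pending for $y$, or if nothing is pending for $y$, $\mathrm{amount}(O)>0$, $\mathrm{sequence}(O)=\mathrm{next}^y(\alpha)$ and $\mathrm{amount}(O)\le\mathrm{balance}^y(\alpha)$, then $O$ is made pending and $\alpha$ answers with its signature of $O$; otherwise $O$ is refused. \item Confirmation order with a valid certificate $C$ from $y$: if $\mathrm{sequence}(C)=\mathrm{next}^y(\alpha)$, then (whatever the balance) $\alpha$ subtracts $\mathrm{amount}(C)$ from $\mathrm{balance}^y(\alpha)$, increments $\mathrm{next}^y(\alpha)$, removes the pending order, records $C$ as confirmed, and, if the recipient is a FastPay account, credits it, at once if it belongs to the same shard of $\alpha$ as $y$ and otherwise through a cross-shard message delivered once, eventually; if $\mathrm{sequence}(C)\neq\mathrm{next}^y(\alpha)$, nothing happens. \end{itemize} The \emph{missing certificates required by $\alpha$} for $y$ up to $m$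 are certificates $C_k,\dots,C_{m-1}$ with $k=\mathrm{next}^y(\alpha)$, $\mathrm{sender}(C_i)=y$, $\mathrm{sequence}(C_i)=i$ (none if $k\ge m$). A user is \emph{correct} if they give to each new transfer order the sequence number following the previous one (starting with $0$) and if, before signing a new transfer order, they obtain a certificate of the previous one and have it delivered to a quorum. Other users behave arbitrarily. \emph{Statement.} Let $x$ be an account owned by a correct user, let $n$ be the next available sequence number after the last transfer order signed by $x$ ($n=0$ if there is none), and let $O$ be a new transfer order signed by $x$ with $\mathrm{sender}(O)=x$, $\mathrm{sequence}(O)=n$ and $\mathrm{amount}(O)>0$. Let $\sigma$ be the chain state known to the user when signing $O$ (a prefix of the actual one), and let $\mathrm{received}(x)$ be the finite set of existing certificates $C$ with $\mathrm{recipient}(C)=x$ known to them at that time. Assume that \[ \mathrm{amount}(O)+\sum_{\mathrm{sender}(C)=x,\ \mathrm{sequence}(C)<n}\mathrm{amount}(C)\ \le\ \mathrm{funding}^x(\sigma)+\sum_{C\in \mathrm{received}(x)}\mathrm{amount}(C), \] where sums over certificates count each certified transfer order once. Let $\alpha$ be an honest authority. Suppose that, after signing $O$, the user sends the following to $\alpha$,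 each of the orders in 1--3 after the previous one has been handled by $\alpha$: \begin{enumerate} \item the synchronization orders of the transactions of $\sigma$ that $\alpha$ lacks, in order; \item a confirmation order for every $C\in\mathrm{received}(x)$, preceded by confirmation orders for the missing certificates required by $\alpha$ for $\mathrm{sender}(C)$ up to $\mathrm{sequence}(C)$; \item confirmation orders for the missing certificates required by $\alpha$ for $x$ itself up to $n$; \item then the transfer order $O$, which is sent again as long as $\alpha$'s signature of it has not been received. \end{enumerate} Then the user eventually obtains a valid signature of $O$ from $\alpha$, unless $\alpha$ confirms a certificate of $O$ (formed from the signatures of other authorities) before it has answered the user with its signature of $O$. -/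

import Mathlib

namespace FastPay

section Definitions

variable (A X P D Sh : Type*)

/-- A FastPay address, or an address on the Primary ledger. -/
inductive Address where
  | fastPay (x : X)
  | primary (p : P)

/-- The content of a transfer order (its signature by the sender is tracked by `GlobalState.signed`);
`D` is the type of the optional user-provided data. -/
structure Order where
  sender : X
  recipient : Address X P
  amount : ℕ
  sequence : ℕ
  data : Option D

/-- A transfer certificate: a transfer order with the authorities whose signatures it carries.
Whether these signatures exist is `GlobalState.Valid`. -/
structure Certificate where
  value : Order X P D
  signers : Finset A

/-- A funding transaction on the Primary. -/
structure Funding where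
  recipient : X
  amount : ℕ

/-- A Primary synchronization order. Transaction indices start at `1`. -/
structure SyncOrder where
  index : ℕ
  recipient : X
  amount : ℕ

/-- The state of one account within one authority (balances may be temporarily negative). -/
structure Account where
  balance : ℤ
  nextSequence : ℕ
  pending : Option (Order X P D)
  confirmed : List (Certificate A X P D)
  synchronized : List (SyncOrder X)

/-- The state of one authority: the accounts in use, the index of the last Primary transaction it
took into account, and the updates that one of its shards sent to another one and that have not been
delivered yet. -/
structure AuthorityState where
  accounts : X → Option (Account A X P D)
  lastTransaction : ℕ
  crossShard : Multiset (Certificate A X P D)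

/-- The requests that clients send to authorities. -/
inductive Request where
  | synchronization (S : SyncOrder X)
  | confirmation (C : Certificate A X P D)
  | transfer (O : Order X P D)

/-- The fixed parameters: a committee of `3 f + 1` authorities, at most `f` of which are Byzantine,
and the assignment by each authority of the accounts to its shards. -/
structure System [Fintype A] where
  f : ℕ
  card_authorities : Fintype.card A = 3 * f + 1
  byzantine : Finset A
  card_byzantine : byzantine.card ≤ f
  shard : A → X → Sh

/-- A global state of the system. Signatures are ideal: a signature is valid exactly if it has been
produced by the holder of the key. Clients are identified with the accounts that they own. -/
structure GlobalState where
  /-- the funding transactions executed so far on the Primary, oldest first -/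
  ledger : List (Funding X)
  /-- the transfer orders that have been signed by their sender -/
  signed : Set (Order X P D)
  /-- the signatures on transfer orders produced by authorities -/
  votes : Set (A × Order X P D)
  /-- the local states of the authorities (meaningful for the honest ones only) -/
  authority : A → AuthorityState A X P D
  /-- the requests sent so far -/
  requests : Set (X × A × Request A X P D)
  /-- the signatures sent back by authorities to clients -/
  replies : Set (X × A × Order X P D)
  /-- the signatures of authorities that clients have received -/
  obtained : Set (X × A × Order X P D)

/-- What can happen in one step. -/
inductive Event where
  /-- nothing happens -/
  | idle
  /-- the Primary executes a funding transaction -/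
  | fund (T : Funding X)
  /-- the owner of the account `O.sender` signs the transfer order `O` -/
  | sign (O : Order X P D)
  /-- the Byzantine authority `β` signs `O` and sends the signature to the client `p` -/
  | byzantineSign (β : A) (O : Order X P D) (p : X)
  /-- the client `p` sends a request to `α` -/
  | send (p : X) (α : A) (r : Request A X P D)
  /-- a request of the client `p` reaches the honest authority `α`, which handles it -/
  | deliver (p : X) (α : A) (r : Request A X P D)
  /-- a cross-shard update of the honest authority `α` reaches the recipient's shard -/
  | crossShard (α : A) (C : Certificate A X P D)
  /-- the client `p` receives from `α` a signature of `O` -/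
  | receive (p : X) (α : A) (O : Order X P D)

end Definitions

variable {A X P D Sh : Type*}

/-- A new account. -/
def Account.new : Account A X P D := ⟨0, 0, none, [], []⟩

namespace AuthorityState

def initial : AuthorityState A X P D := ⟨fun _ => none, 0, 0⟩

/-- The account of `y`, a new one if it is not in use yet. -/
def account (s : AuthorityState A X P D) (y : X) : Account A X P D :=
  (s.accounts y).getD Account.new

open scoped Classical in
noncomputable def setAccount (s : AuthorityState A X P D) (y : X) (a : Account A X P D) :
    AuthorityState A X P D :=
  { s with accounts := Function.update s.accounts y (some a) }

/-- Increase the balance of `y`, which is created if needed. -/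
noncomputable def credit (s : AuthorityState A X P D) (y : X) (v : ℕ) : AuthorityState A X P D :=
  s.setAccount y { s.account y with balance := (s.account y).balance + v }

open scoped Classical in
/-- Handling a transfer order whose signature is valid: `none` if it is refused, otherwise the new
state, in which the order is pending (and the authority signs it). -/
noncomputable def handleTransfer (s : AuthorityState A X P D) (O : Order X P D) :
    Option (AuthorityState A X P D) :=
  match s.accounts O.sender with
  | none => none
  | some a =>
    match a.pending with
    | some O' => if O' = O then some s else none
    | none =>
      if 0 < O.amount ∧ a.nextSequence = O.sequence ∧ (O.amount : ℤ) ≤ a.balance then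
        some (s.setAccount O.sender { a with pending := some O })
      else none

open scoped Classical in
/-- Handling a confirmation order whose certificate is valid. Certificates that do not have the
expected sequence number have no effect. The balance of the sender may become negative. -/
noncomputable def handleConfirmation (shard : X → Sh) (s : AuthorityState A X P D)
    (C : Certificate A X P D) : AuthorityState A X P D :=
  let x := C.value.sender
  let a := s.account x
  if a.nextSequence = C.value.sequence then
    let s' := s.setAccount x
      { a with
        balance := a.balance - C.value.amount
        nextSequence := a.nextSequence + 1
        pending := none
        confirmed := a.confirmed ++ [C] }
    match C.value.recipient with
    | .primary _ => s'
    | .fastPay y =>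
      if shard y = shard x then s'.credit y C.value.amount
      else { s' with crossShard := C ::ₘ s'.crossShard }
  else s

open scoped Classical in
/-- Handling a cross-shard update, which is consumed. -/
noncomputable def handleCrossShard (s : AuthorityState A X P D) (C : Certificate A X P D) :
    AuthorityState A X P D :=
  let s' := { s with crossShard := s.crossShard.erase C }
  match C.value.recipient with
  | .primary _ => s'
  | .fastPay y => s'.credit y C.value.amount

open scoped Classical in
/-- Handling an authentic synchronization order. Orders that do not have the expected transaction
index have no effect. -/
noncomputable def handleSynchronization (s : AuthorityState A X P D) (S : SyncOrder X) :
    AuthorityState A X P D :=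
  if S.index = s.lastTransaction + 1 then
    let a := s.account S.recipient
    { s.setAccount S.recipient
        { a with
          balance := a.balance + S.amount
          synchronized := a.synchronized ++ [S] } with
      lastTransaction := s.lastTransaction + 1 }
  else s

end AuthorityState

namespace System

variable [Fintype A]

def Honest (sys : System A X Sh) (α : A) : Prop := α ∉ sys.byzantine

/-- A set of authorities that contains `2 f + 1` of them. -/
def IsQuorum (sys : System A X Sh) (Q : Finset A) : Prop := 2 * sys.f + 1 ≤ Q.card

end System

/-- The synchronization orders that the Primary generates for the transactions of the chain `σ`, in
the order of their transaction indices. -/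
def syncOrders (σ : List (Funding X)) : List (SyncOrder X) :=
  σ.mapIdx fun i T => ⟨i + 1, T.recipient, T.amount⟩

open scoped Classical in
/-- The sum of the amounts transferred to the address `x` from the Primary in the chain `σ`. -/
noncomputable def funding (x : X) (σ : List (Funding X)) : ℕ :=
  (σ.map fun T => if T.recipient = x then T.amount else 0).sum

namespace GlobalState

def initial : GlobalState A X P D :=
  ⟨[], ∅, ∅, fun _ => AuthorityState.initial, ∅, ∅, ∅⟩

variable [Fintype A]

/-- The certificate is signed by a quorum of authorities. -/
def Valid (sys : System A X Sh) (s : GlobalState A X P D) (C : Certificate A X P D) : Prop :=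
  sys.IsQuorum C.signers ∧ ∀ β ∈ C.signers, (β, C.value) ∈ s.votes

/-- There is a valid certificate of the order. -/
def Certified (sys : System A X Sh) (s : GlobalState A X P D) (O : Order X P D) : Prop :=
  ∃ C : Certificate A X P D, s.Valid sys C ∧ C.value = O

/-- The next sequence number of the account `y` as seen by the authority `α`. -/
def nextSequence (s : GlobalState A X P D) (α : A) (y : X) : ℕ :=
  ((s.authority α).account y).nextSequence

/-- The transfer certificates from the account `y` confirmed by the authority `α`. -/
def confirmed (s : GlobalState A X P D) (α : A) (y : X) : List (Certificate A X P D) :=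
  ((s.authority α).account y).confirmed

open scoped Classical in
noncomputable def setAuthority (s : GlobalState A X P D) (α : A) (a : AuthorityState A X P D) :
    GlobalState A X P D :=
  { s with authority := Function.update s.authority α a }

open scoped Classical in
/-- The honest authority `α` handles a request of the client `p`: it checks the authenticity of the
request, runs the handler of the request, and answers an accepted transfer order by its signature. -/
noncomputable def handle (sys : System A X Sh) (s : GlobalState A X P D) (p : X) (α : A) :
    Request A X P D → GlobalState A X P D
  | .synchronization S =>
    if S ∈ syncOrders s.ledger then
      s.setAuthority α ((s.authority α).handleSynchronization S)
    else s
  | .confirmation C =>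
    if s.Valid sys C then
      s.setAuthority α ((s.authority α).handleConfirmation (sys.shard α) C)
    else s
  | .transfer O =>
    if O ∈ s.signed then
      match (s.authority α).handleTransfer O with
      | none => s
      | some a =>
        { s.setAuthority α a with
          votes := insert (α, O) s.votes
          replies := insert (p, α, O) s.replies }
    else s

end GlobalState

section Runs

variable [Fintype A]

/-- The transitions of the system. The adversary chooses the events: the transactions on the
Primary, the behaviour of the users and of the Byzantine authorities, and the moments at which
messages (possibly repeatedly, and in any order) reach their destination. -/
inductive Step (sys : System A X Sh) :
    GlobalState A X P D → Event A X P D → GlobalState A X P D → Prop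
  | idle (s) : Step sys s .idle s
  | fund (s) (T : Funding X) : Step sys s (.fund T) { s with ledger := s.ledger ++ [T] }
  | sign (s) (O : Order X P D) : Step sys s (.sign O) { s with signed := insert O s.signed }
  | byzantineSign (s) (β : A) (O : Order X P D) (p : X) (hβ : ¬ sys.Honest β) :
      Step sys s (.byzantineSign β O p)
        { s with votes := insert (β, O) s.votes, replies := insert (p, β, O) s.replies }
  | send (s) (p : X) (α : A) (r : Request A X P D) :
      Step sys s (.send p α r) { s with requests := insert (p, α, r) s.requests }
  | deliver (s) (p : X) (α : A) (r : Request A X P D) (hα : sys.Honest α)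
      (hr : (p, α, r) ∈ s.requests) : Step sys s (.deliver p α r) (s.handle sys p α r)
  | crossShard (s) (α : A) (C : Certificate A X P D) (hα : sys.Honest α)
      (hC : C ∈ (s.authority α).crossShard) :
      Step sys s (.crossShard α C) (s.setAuthority α ((s.authority α).handleCrossShard C))
  | receive (s) (p : X) (α : A) (O : Order X P D) (h : (p, α, O) ∈ s.replies) :
      Step sys s (.receive p α O) { s with obtained := insert (p, α, O) s.obtained }

variable (P D) in
/-- An infinite execution. -/
structure Run (sys : System A X Sh) where
  state : ℕ → GlobalState A X P D
  event : ℕ → Event A X P D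
  state_zero : state 0 = GlobalState.initial
  step : ∀ t, Step sys (state t) (event t) (state (t + 1))

namespace Run

variable {sys : System A X Sh}

/-- Messages to and from honest authorities, and between their shards, are eventually delivered. -/
structure Fair (R : Run P D sys) : Prop where
  request : ∀ t p α r, sys.Honest α → R.event t = .send p α r →
    ∃ t' > t, R.event t' = .deliver p α r
  crossShard : ∀ t α C, sys.Honest α → C ∈ ((R.state t).authority α).crossShard →
    ∃ t' ≥ t, R.event t' = .crossShard α C
  reply : ∀ t p α O, sys.Honest α → (p, α, O) ∈ (R.state t).replies →
    ∃ t' ≥ t, R.event t' = .receive p α O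

/-- The owner of `x` is a correct user: whenever they sign a new transfer order,
its sequence number is the one following those used so far, which start with `0`, and there is a
certificate of every order that they signed before. (That these certificates have also been delivered
to a quorum of authorities is not demanded: the class of users considered is only larger.) -/
structure CorrectUser (R : Run P D sys) (x : X) : Prop where
  sequence : ∀ t O, R.event t = .sign O → O.sender = x →
    ∀ m, (∃ O' ∈ (R.state t).signed, O'.sender = x ∧ O'.sequence = m) ↔ m < O.sequence
  certified : ∀ t O, R.event t = .sign O → O.sender = x →
    ∀ O' ∈ (R.state t).signed, O'.sender = x → (R.state t).Certified sys O'

/-- From time `t` on, the client `p` sends to `α` the requests of a list, each one after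
the previous one has been handled by `α`; the last one has been handled before time `t'`. -/
inductive Transmits (R : Run P D sys) (p : X) (α : A) : List (Request A X P D) → ℕ → ℕ → Prop
  | nil (t : ℕ) : Transmits R p α [] t t
  | cons (r : Request A X P D) (L : List (Request A X P D)) (t u v t' : ℕ)
      (htu : t ≤ u) (hu : R.event u = .send p α r)
      (huv : u < v) (hv : R.event v = .deliver p α r)
      (hL : Transmits R p α L (v + 1) t') : Transmits R p α (r :: L) t t'

/-- Valid certificates (at time `t`) from the account `y` with the sequence numbers `k, …, m - 1`,
in this order. -/
def IsCertificateChain (R : Run P D sys) (t : ℕ) (y : X) (k m : ℕ)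
    (L : List (Certificate A X P D)) : Prop :=
  (∀ C ∈ L, (R.state t).Valid sys C ∧ C.value.sender = y) ∧
    L.map (fun C => C.value.sequence) = List.range' k (m - k)

/-- Between `t` and `t'`, `p` synchronizes `α` with the chain `σ`: it sends the synchronization
orders of all transactions of `σ` that `α` lacks (possibly preceded by some that `α` has). -/
def Synchronizes (R : Run P D sys) (p : X) (α : A) (σ : List (Funding X)) (t t' : ℕ) : Prop :=
  ∃ u ≥ t, ∃ k ≤ ((R.state u).authority α).lastTransaction,
    R.Transmits p α (((syncOrders σ).drop k).map .synchronization) u t'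

/-- Between `t` and `t'`, `p` sends to `α` confirmation orders for the certificates missing at `α`
among those from `y` with sequence numbers less than `m` (possibly preceded by some that `α` has),
then the requests in `next`. -/
def SendsMissing (R : Run P D sys) (p : X) (α : A) (y : X) (m : ℕ)
    (next : List (Request A X P D)) (t t' : ℕ) : Prop :=
  ∃ u ≥ t, ∃ k ≤ (R.state u).nextSequence α y, ∃ L, R.IsCertificateChain u y k m L ∧
    R.Transmits p α (L.map .confirmation ++ next) u t'

/-- Between `t` and `t'`, `p` sends to `α` a confirmation order for each of the certificates of a
list, preceded by the missing certificates required by `α` for its sender. -/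
inductive Confirms (R : Run P D sys) (p : X) (α : A) :
    List (Certificate A X P D) → ℕ → ℕ → Prop
  | nil (t : ℕ) : Confirms R p α [] t t
  | cons (C : Certificate A X P D) (L : List (Certificate A X P D)) (t u t' : ℕ)
      (hC : R.SendsMissing p α C.value.sender C.value.sequence [.confirmation C] t u)
      (hL : Confirms R p α L u t') : Confirms R p α (C :: L) t t'

/-- From time `t` on, `p` keeps sending the order `O` to `α` as long as `p` has not received
a signature of `O` from `α`. -/
def KeepsSending (R : Run P D sys) (p : X) (α : A) (O : Order X P D) (t : ℕ) : Prop :=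
  ∀ u ≥ t, (p, α, O) ∉ (R.state u).obtained → ∃ v ≥ u, R.event v = .send p α (.transfer O)

end Run

end Runs

end FastPay

/-! If `α` ever answers the user with its signature of `O`, fairness brings the answer back. So
suppose that it never does. If from `t₃` on the next number of `x` at `α` ever exceeds that of `O`,
then `α` has confirmed a certificate from `x` with the number of `O`. Its quorum contains an honest
authority, which votes only for orders signed by their sender, and a correct user signs a single
order per number; so this is a certificate of `O`, which is the exception allowed by the statement.
Otherwise the number stays equal to that of `O`, because the missing certificates have raised it
that far. Then a retransmission of `O` is eventually accepted, a contradiction: anything pending for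
`x` is `O` itself, and the balance suffices.

The balance is the heart of the matter. Accounts keep no record of the transfers credited to them,
so a multiset `G` of credited orders is carried along as a ghost variable
(`AuthorityState.Balanced`, `Run.exists_credits`), with balance + confirmed outgoing amounts =
funding of the processed part of the ledger + total of `G`. Three estimates enter. The processed
part extends `σ` (`Synchronizes.length_le`). `G` eventually contains every received transfer, since
a confirmed one is either credited or waiting in the cross-shard queue
(`Fair.eventually_mem_credits`). The outgoing amounts are at most those certified when `O` was
signed (`CorrectUser.sum_confirmed_le`).

Safety comes from the inductive invariant `WellFormed`: an honest authority never votes for two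
orders with the same sender and number. By quorum intersection, a certificate's sender and number
then determine its order (`value_unique`). Interference by other clients is harmless because the
counters never decrease (`Grows`), so lower bounds on them persist. -/

namespace FastPay

variable {A X P D Sh : Type*}

/-! ### Effects of the handlers on a single account -/

/-- The part of an account that credits leave unchanged. -/
def Account.history (a : Account A X P D) :
    ℕ × Option (Order X P D) × List (Certificate A X P D) :=
  (a.nextSequence, a.pending, a.confirmed)

lemma Account.history_eq_iff {a b : Account A X P D} :
    a.history = b.history ↔
      a.nextSequence = b.nextSequence ∧ a.pending = b.pending ∧ a.confirmed = b.confirmed := by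
  simp [Account.history]

namespace AuthorityState

open scoped Classical in
lemma account_setAccount (s : AuthorityState A X P D) (y : X) (a : Account A X P D) (z : X) :
    (s.setAccount y a).account z = if z = y then a else s.account z := by
  by_cases h : z = y
  · subst h; simp [account, setAccount]
  · simp [account, setAccount, h]

lemma account_congr {s s' : AuthorityState A X P D} (h : s.accounts = s'.accounts) (z : X) :
    s.account z = s'.account z := by
  simp [account, h]

lemma history_credit (s : AuthorityState A X P D) (y : X) (v : ℕ) (z : X) :
    ((s.credit y v).account z).history = (s.account z).history := by
  rw [credit, account_setAccount]
  split_ifs with h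
  · subst h; rfl
  · rfl

open scoped Classical in
lemma balance_credit (s : AuthorityState A X P D) (y : X) (v : ℕ) (z : X) :
    ((s.credit y v).account z).balance = (s.account z).balance + if y = z then (v : ℤ) else 0 := by
  rw [credit, account_setAccount]
  by_cases h : z = y
  · subst h; simp
  · simp [h, Ne.symm h]

lemma history_handleCrossShard (s : AuthorityState A X P D) (C : Certificate A X P D) (z : X) :
    ((s.handleCrossShard C).account z).history = (s.account z).history := by
  unfold handleCrossShard
  cases C.value.recipient with
  | primary p => rfl
  | fastPay y => exact history_credit _ _ _ _

open scoped Classical in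
lemma balance_handleCrossShard (s : AuthorityState A X P D) (C : Certificate A X P D) (z : X) :
    ((s.handleCrossShard C).account z).balance =
      (s.account z).balance + if C.value.recipient = .fastPay z then (C.value.amount : ℤ) else 0 := by
  unfold handleCrossShard
  cases C.value.recipient with
  | primary p => simp [account]
  | fastPay y =>
    refine (balance_credit _ _ _ _).trans ?_
    simp [account]

open scoped Classical in
lemma crossShard_handleCrossShard (s : AuthorityState A X P D) (C : Certificate A X P D) :
    (s.handleCrossShard C).crossShard = s.crossShard.erase C := by
  unfold handleCrossShard
  cases C.value.recipient <;> rfl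

lemma lastTransaction_handleCrossShard (s : AuthorityState A X P D) (C : Certificate A X P D) :
    (s.handleCrossShard C).lastTransaction = s.lastTransaction := by
  unfold handleCrossShard
  cases C.value.recipient <;> rfl

lemma history_handleSynchronization (s : AuthorityState A X P D) (S : SyncOrder X) (z : X) :
    ((s.handleSynchronization S).account z).history = (s.account z).history := by
  unfold handleSynchronization
  split_ifs with h
  · refine Eq.trans (congrArg _ (account_congr (s' := s.setAccount S.recipient _) rfl z)) ?_
    rw [account_setAccount]
    split_ifs with h
    · subst h; rfl
    · rfl
  · rfl

open scoped Classical in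
lemma balance_handleSynchronization {s : AuthorityState A X P D} {S : SyncOrder X}
    (h : S.index = s.lastTransaction + 1) (z : X) :
    ((s.handleSynchronization S).account z).balance =
      (s.account z).balance + if S.recipient = z then (S.amount : ℤ) else 0 := by
  unfold handleSynchronization
  rw [if_pos h]
  refine Eq.trans
    (congrArg _ (account_congr (s' := s.setAccount S.recipient _) rfl z)) ?_
  rw [account_setAccount]
  by_cases h : z = S.recipient
  · subst h; simp
  · simp [h, Ne.symm h]

lemma crossShard_handleSynchronization (s : AuthorityState A X P D) (S : SyncOrder X) :
    (s.handleSynchronization S).crossShard = s.crossShard := by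
  unfold handleSynchronization
  split_ifs <;> rfl

open scoped Classical in
lemma lastTransaction_handleSynchronization (s : AuthorityState A X P D) (S : SyncOrder X) :
    (s.handleSynchronization S).lastTransaction =
      if S.index = s.lastTransaction + 1 then s.lastTransaction + 1 else s.lastTransaction := by
  unfold handleSynchronization
  split_ifs <;> rfl

lemma handleConfirmation_of_ne (shard : X → Sh) {s : AuthorityState A X P D}
    {C : Certificate A X P D}
    (h : (s.account C.value.sender).nextSequence ≠ C.value.sequence) :
    s.handleConfirmation shard C = s := by
  unfold handleConfirmation
  exact if_neg h

-- Only the debit of the sender touches a history. The credit of the recipient changes at most a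
-- balance, even when an account pays itself.
open scoped Classical in
lemma history_handleConfirmation (shard : X → Sh) {s : AuthorityState A X P D}
    {C : Certificate A X P D}
    (h : (s.account C.value.sender).nextSequence = C.value.sequence) (z : X) :
    ((s.handleConfirmation shard C).account z).history =
      if z = C.value.sender then
        ((s.account z).nextSequence + 1, none, (s.account z).confirmed ++ [C])
      else (s.account z).history := by
  have key : ∀ b l, ((s.setAccount C.value.sender
      { balance := b, nextSequence := (s.account C.value.sender).nextSequence + 1,
        pending := none, confirmed := (s.account C.value.sender).confirmed ++ [C],
        synchronized := l }).account z).history = if z = C.value.sender then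
        ((s.account z).nextSequence + 1, none, (s.account z).confirmed ++ [C])
      else (s.account z).history := by
    intro b l
    rw [account_setAccount]
    split_ifs with hz
    · subst hz; rfl
    · rfl
  unfold handleConfirmation
  simp only [if_pos h]
  cases C.value.recipient with
  | primary p => exact key _ _
  | fastPay y =>
    dsimp only
    split_ifs with h1 h2 h2
    · rw [history_credit]; simpa [h2] using key _ _
    · rw [history_credit]; simpa [h2] using key _ _
    · exact (key _ _).trans (if_pos h2)
    · exact (key _ _).trans (if_neg h2)

open scoped Classical in
lemma balance_handleConfirmation (shard : X → Sh) {s : AuthorityState A X P D}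
    {C : Certificate A X P D}
    (h : (s.account C.value.sender).nextSequence = C.value.sequence) (z : X) :
    ((s.handleConfirmation shard C).account z).balance =
      (s.account z).balance - (if z = C.value.sender then (C.value.amount : ℤ) else 0) +
        if C.value.recipient = .fastPay z ∧ shard z = shard C.value.sender then
          (C.value.amount : ℤ) else 0 := by
  have key : ∀ n p c l, ((s.setAccount C.value.sender
      { balance := (s.account C.value.sender).balance - C.value.amount, nextSequence := n,
        pending := p, confirmed := c, synchronized := l }).account z).balance =
      (s.account z).balance - (if z = C.value.sender then (C.value.amount : ℤ) else 0) := by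
    intro n p c l
    rw [account_setAccount]
    split_ifs with hz
    · subst hz; rfl
    · simp
  unfold handleConfirmation
  simp only [if_pos h]
  cases C.value.recipient with
  | primary p => simpa using key _ _ _ _
  | fastPay y =>
    dsimp only
    by_cases h1 : shard y = shard C.value.sender
    · rw [if_pos h1, balance_credit, key]
      by_cases hy : y = z
      · subst hy; simp [h1]
      · simp [hy]
    · rw [if_neg h1]
      refine (key _ _ _ _).trans ?_
      by_cases hy : y = z
      · subst hy; simp [h1]
      · simp [hy]

lemma mem_crossShard_handleConfirmation (shard : X → Sh) {s : AuthorityState A X P D}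
    {C : Certificate A X P D}
    (h : (s.account C.value.sender).nextSequence = C.value.sequence) {y : X}
    (hy : C.value.recipient = .fastPay y) (hne : shard y ≠ shard C.value.sender) :
    C ∈ (s.handleConfirmation shard C).crossShard := by
  unfold handleConfirmation
  simp only [if_pos h]
  rw [hy]
  simp [hne]

lemma crossShard_le_handleConfirmation (shard : X → Sh) (s : AuthorityState A X P D)
    (C : Certificate A X P D) : s.crossShard ≤ (s.handleConfirmation shard C).crossShard := by
  unfold handleConfirmation
  dsimp only
  split_ifs
  · cases C.value.recipient with
    | primary p => exact le_rfl
    | fastPay y =>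
      dsimp only
      split_ifs
      · exact le_rfl
      · exact Multiset.le_cons_self _ _
  · exact le_rfl

lemma lastTransaction_handleConfirmation (shard : X → Sh) (s : AuthorityState A X P D)
    (C : Certificate A X P D) :
    (s.handleConfirmation shard C).lastTransaction = s.lastTransaction := by
  unfold handleConfirmation
  dsimp only
  split_ifs
  · cases C.value.recipient with
    | primary p => rfl
    | fastPay y => dsimp only; split_ifs <;> rfl
  · rfl

/-- The effects of an accepted transfer order. -/
structure Accepts (s : AuthorityState A X P D) (O : Order X P D) (s' : AuthorityState A X P D) :
    Prop where
  pending_or : (s.account O.sender).pending = some O ∨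
    (s.account O.sender).pending = none ∧ (s.account O.sender).nextSequence = O.sequence
  pending : (s'.account O.sender).pending = some O
  pending_of_ne : ∀ z ≠ O.sender, (s'.account z).pending = (s.account z).pending
  nextSequence : ∀ z, (s'.account z).nextSequence = (s.account z).nextSequence
  confirmed : ∀ z, (s'.account z).confirmed = (s.account z).confirmed
  balance : ∀ z, (s'.account z).balance = (s.account z).balance
  lastTransaction : s'.lastTransaction = s.lastTransaction
  crossShard : s'.crossShard = s.crossShard

lemma accepts_of_handleTransfer {s s' : AuthorityState A X P D} {O : Order X P D}
    (h : s.handleTransfer O = some s') : s.Accepts O s' := by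
  unfold handleTransfer at h
  cases ha : s.accounts O.sender with
  | none => simp [ha] at h
  | some a =>
    have hacc : s.account O.sender = a := by simp [account, ha]
    simp only [ha] at h
    cases hp : a.pending with
    | some O' =>
      simp only [hp] at h
      split_ifs at h with hO
      subst hO
      cases h
      have : (s.account O'.sender).pending = some O' := by rw [hacc, hp]
      exact ⟨.inl this, this, fun _ _ => rfl, fun _ => rfl, fun _ => rfl, fun _ => rfl, rfl, rfl⟩
    | none =>
      simp only [hp] at h
      split_ifs at h with hO
      cases h
      refine ⟨.inr ⟨by rw [hacc, hp], by rw [hacc, hO.2.1]⟩, ?_, ?_, ?_, ?_, ?_, rfl, rfl⟩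
      · simp [account_setAccount]
      · intro z hz; simp [account_setAccount, hz]
      all_goals
        intro z
        rw [account_setAccount]
        split_ifs with hz
        · subst hz; rw [hacc]
        · rfl

lemma exists_handleTransfer {s : AuthorityState A X P D} {O : Order X P D} (hpos : 0 < O.amount)
    (hp : ∀ O', (s.account O.sender).pending = some O' → O' = O)
    (hn : (s.account O.sender).nextSequence = O.sequence)
    (hb : (O.amount : ℤ) ≤ (s.account O.sender).balance) : ∃ s', s.handleTransfer O = some s' := by
  unfold handleTransfer
  cases ha : s.accounts O.sender with
  | none =>
    -- An account that is not in use reads as a new one, whose balance 0 cannot cover a positive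
    -- amount. Hence the bound on the balance already forces the account to exist.
    have : s.account O.sender = Account.new := by simp [account, ha]
    rw [this] at hb
    simp only [Account.new] at hb
    omega
  | some a =>
    have hacc : s.account O.sender = a := by simp [account, ha]
    rw [hacc] at hp hn hb
    dsimp only
    cases hpa : a.pending with
    | some O' => exact ⟨s, if_pos (hp O' hpa)⟩
    | none => exact ⟨_, if_pos ⟨hpos, hn, hb⟩⟩

end AuthorityState

/-! ### Synchronization orders and funding of ledger prefixes -/

section Ledger

lemma map_index_syncOrders (σ : List (Funding X)) :
    (syncOrders σ).map SyncOrder.index = List.range' 1 σ.length := by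
  apply List.ext_getElem
  · simp [syncOrders]
  · intro i h1 h2
    simp [syncOrders, add_comm]

lemma length_syncOrders (σ : List (Funding X)) : (syncOrders σ).length = σ.length := by
  simp [syncOrders]

lemma mem_syncOrders {σ : List (Funding X)} {S : SyncOrder X} :
    S ∈ syncOrders σ ↔ ∃ i, ∃ h : i < σ.length, S = ⟨i + 1, σ[i].recipient, σ[i].amount⟩ := by
  simp only [syncOrders, List.mem_mapIdx, eq_comm]

lemma syncOrders_subset {σ τ : List (Funding X)} (h : σ <+: τ) : syncOrders σ ⊆ syncOrders τ := by
  obtain ⟨ρ, rfl⟩ := h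
  simp [syncOrders, List.mapIdx_append]

lemma funding_append (x : X) (σ τ : List (Funding X)) :
    funding x (σ ++ τ) = funding x σ + funding x τ := by
  simp [funding]

lemma funding_le_of_prefix (x : X) {σ τ : List (Funding X)} (h : σ <+: τ) :
    funding x σ ≤ funding x τ := by
  obtain ⟨ρ, rfl⟩ := h
  rw [funding_append]
  exact Nat.le_add_right _ _

open scoped Classical in
lemma funding_take_succ (x : X) (σ : List (Funding X)) (i : ℕ) (h : i < σ.length) :
    funding x (σ.take (i + 1)) =
      funding x (σ.take i) + if σ[i].recipient = x then σ[i].amount else 0 := by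
  rw [← List.take_append_getElem h, funding_append]
  simp [funding]

end Ledger

/-! ### Quorum intersection -/

namespace System

variable [Fintype A] {sys : System A X Sh}

/-- Two sets of at least `2 f + 1` among `3 f + 1` authorities share at least `f + 1`, and at most
`f` of these are Byzantine. -/
lemma IsQuorum.exists_honest_inter {Q Q' : Finset A} (h : sys.IsQuorum Q) (h' : sys.IsQuorum Q') :
    ∃ β ∈ Q, β ∈ Q' ∧ sys.Honest β := by
  classical
  by_contra! hc
  have hsub : Q ∩ Q' ⊆ sys.byzantine := by
    intro β hβ
    rw [Finset.mem_inter] at hβ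
    exact not_not.1 (hc β hβ.1 hβ.2)
  have h1 := (Finset.card_le_card hsub).trans sys.card_byzantine
  have h2 := Finset.card_union_add_card_inter Q Q'
  have h3 := (Finset.card_le_univ (Q ∪ Q')).trans_eq sys.card_authorities
  unfold IsQuorum at h h'
  omega

lemma IsQuorum.exists_honest {Q : Finset A} (h : sys.IsQuorum Q) : ∃ β ∈ Q, sys.Honest β := by
  obtain ⟨β, hβ, -, hh⟩ := h.exists_honest_inter h
  exact ⟨β, hβ, hh⟩

end System

/-! ### Safety invariants and their preservation -/

namespace GlobalState

lemma authority_setAuthority_self (s : GlobalState A X P D) (α : A) (a : AuthorityState A X P D) :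
    (s.setAuthority α a).authority α = a := by
  simp [setAuthority]

lemma authority_setAuthority_of_ne (s : GlobalState A X P D) {α β : A} (h : β ≠ α)
    (a : AuthorityState A X P D) : (s.setAuthority α a).authority β = s.authority β := by
  simp [setAuthority, h]

variable [Fintype A]

lemma Valid.mono {sys : System A X Sh} {s s' : GlobalState A X P D} (h : s.votes ⊆ s'.votes)
    {C : Certificate A X P D} (hC : s.Valid sys C) : s'.Valid sys C :=
  ⟨hC.1, fun β hβ => h (hC.2 β hβ)⟩

/-- The safety invariants of the reachable states. -/
structure WellFormed (sys : System A X Sh) (s : GlobalState A X P D) : Prop where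
  signed_of_vote : ∀ β O, sys.Honest β → (β, O) ∈ s.votes → O ∈ s.signed
  vote : ∀ β O, sys.Honest β → (β, O) ∈ s.votes →
    O.sequence < s.nextSequence β O.sender ∨
      ((s.authority β).account O.sender).pending = some O
  pending : ∀ β y O, sys.Honest β → ((s.authority β).account y).pending = some O →
    O.sender = y ∧ O.sequence = s.nextSequence β y ∧ (β, O) ∈ s.votes
  vote_unique : ∀ β O O', sys.Honest β → (β, O) ∈ s.votes → (β, O') ∈ s.votes →
    O.sender = O'.sender → O.sequence = O'.sequence → O = O'
  confirmed : ∀ β y, sys.Honest β → ∀ C ∈ s.confirmed β y, s.Valid sys C ∧ C.value.sender = y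
  map_sequence_confirmed : ∀ β y, sys.Honest β →
    (s.confirmed β y).map (fun C => C.value.sequence) = List.range (s.nextSequence β y)
  reply : ∀ p β O, (p, β, O) ∈ s.replies → (β, O) ∈ s.votes

namespace WellFormed

variable {sys : System A X Sh} {s s' : GlobalState A X P D}

lemma initial : (initial : GlobalState A X P D).WellFormed sys := by
  constructor <;>
    simp [GlobalState.initial, AuthorityState.initial, AuthorityState.account, Account.new,
      GlobalState.confirmed, GlobalState.nextSequence]

lemma signed_of_valid (hs : s.WellFormed sys) {C : Certificate A X P D} (hC : s.Valid sys C) :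
    C.value ∈ s.signed := by
  obtain ⟨β, hβ, hh⟩ := hC.1.exists_honest
  exact hs.signed_of_vote β _ hh (hC.2 β hβ)

/-- The two quorums share an honest authority, and it votes once per sender and number. Only the
orders coincide; the sets of signers may differ. -/
lemma value_unique (hs : s.WellFormed sys) {C C' : Certificate A X P D} (hC : s.Valid sys C)
    (hC' : s.Valid sys C') (hsender : C.value.sender = C'.value.sender)
    (hseq : C.value.sequence = C'.value.sequence) : C.value = C'.value := by
  obtain ⟨β, hβ, hβ', hh⟩ := hC.1.exists_honest_inter hC'.1
  exact hs.vote_unique β _ _ hh (hC.2 β hβ) (hC'.2 β hβ') hsender hseq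

/-- The numbers of the confirmed certificates are exactly those below the next one, without gaps. -/
lemma exists_confirmed (hs : s.WellFormed sys) {β : A} (hβ : sys.Honest β) {y : X} {k : ℕ}
    (hk : k < s.nextSequence β y) : ∃ C ∈ s.confirmed β y, C.value.sequence = k := by
  have := List.mem_range.2 hk
  rw [← hs.map_sequence_confirmed β y hβ] at this
  simpa using this

/-- The invariants are preserved if honest authorities neither sign anything nor change the
history of an account. -/
lemma of_history_eq (hs : s.WellFormed sys) (hsigned : s.signed ⊆ s'.signed)
    (hvotes : s.votes ⊆ s'.votes)
    (hhonest : ∀ β O, sys.Honest β → (β, O) ∈ s'.votes → (β, O) ∈ s.votes)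
    (hhistory : ∀ β y, ((s'.authority β).account y).history =
      ((s.authority β).account y).history)
    (hreply : ∀ p β O, (p, β, O) ∈ s'.replies → (β, O) ∈ s'.votes) : s'.WellFormed sys := by
  have hn : ∀ β y, s'.nextSequence β y = s.nextSequence β y := fun β y =>
    (Account.history_eq_iff.1 (hhistory β y)).1
  have hp : ∀ β y, ((s'.authority β).account y).pending = ((s.authority β).account y).pending :=
    fun β y => (Account.history_eq_iff.1 (hhistory β y)).2.1
  have hc : ∀ β y, s'.confirmed β y = s.confirmed β y := fun β y =>
    (Account.history_eq_iff.1 (hhistory β y)).2.2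
  refine ⟨fun β O h1 h2 => hsigned (hs.signed_of_vote β O h1 (hhonest β O h1 h2)), ?_, ?_, ?_, ?_,
    ?_, hreply⟩
  · intro β O h1 h2
    rw [hn, hp]
    exact hs.vote β O h1 (hhonest β O h1 h2)
  · intro β y O h1 h2
    rw [hp] at h2
    rw [hn]
    obtain ⟨h3, h4, h5⟩ := hs.pending β y O h1 h2
    exact ⟨h3, h4, hvotes h5⟩
  · intro β O O' h1 h2 h3
    exact hs.vote_unique β O O' h1 (hhonest _ _ h1 h2) (hhonest _ _ h1 h3)
  · intro β y h1 C hC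
    rw [hc] at hC
    exact ⟨(hs.confirmed β y h1 C hC).1.mono hvotes, (hs.confirmed β y h1 C hC).2⟩
  · intro β y h1
    rw [hc, hn]
    exact hs.map_sequence_confirmed β y h1

lemma setAuthority (hs : s.WellFormed sys) {α : A} {a : AuthorityState A X P D}
    (h : ∀ y, (a.account y).history = ((s.authority α).account y).history) :
    (s.setAuthority α a).WellFormed sys := by
  refine hs.of_history_eq subset_rfl subset_rfl (fun _ _ _ => id) ?_ hs.reply
  intro β y
  by_cases hβ : β = α
  · subst hβ; rw [authority_setAuthority_self, h]
  · rw [authority_setAuthority_of_ne _ hβ]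

/-- Dropping the pending order is safe: it carries the old next number, which lies below the
incremented one, so its vote becomes outdated and the number can never be voted on again. -/
lemma handleConfirmation (hs : s.WellFormed sys) (α : A) {C : Certificate A X P D}
    (hC : s.Valid sys C) :
    (s.setAuthority α ((s.authority α).handleConfirmation (sys.shard α) C)).WellFormed sys := by
  by_cases h : ((s.authority α).account C.value.sender).nextSequence = C.value.sequence
  swap
  · rw [AuthorityState.handleConfirmation_of_ne _ h]
    exact hs.setAuthority fun _ => rfl
  set s' := s.setAuthority α ((s.authority α).handleConfirmation (sys.shard α) C) with hs'
  have hhist : ∀ β y, ¬ (β = α ∧ y = C.value.sender) →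
      ((s'.authority β).account y).history = ((s.authority β).account y).history := by
    intro β y hne
    by_cases hβ : β = α
    · subst hβ
      rw [hs', authority_setAuthority_self, AuthorityState.history_handleConfirmation _ h, if_neg]
      exact fun hy => hne ⟨rfl, hy⟩
    · rw [hs', authority_setAuthority_of_ne _ hβ]
  have hn : ∀ β y, ¬ (β = α ∧ y = C.value.sender) → s'.nextSequence β y = s.nextSequence β y :=
    fun β y hne => (Account.history_eq_iff.1 (hhist β y hne)).1
  have hp : ∀ β y, ¬ (β = α ∧ y = C.value.sender) →
      ((s'.authority β).account y).pending = ((s.authority β).account y).pending :=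
    fun β y hne => (Account.history_eq_iff.1 (hhist β y hne)).2.1
  have hc : ∀ β y, ¬ (β = α ∧ y = C.value.sender) → s'.confirmed β y = s.confirmed β y :=
    fun β y hne => (Account.history_eq_iff.1 (hhist β y hne)).2.2
  have hhist' : ((s'.authority α).account C.value.sender).history =
      (s.nextSequence α C.value.sender + 1, none, s.confirmed α C.value.sender ++ [C]) := by
    rw [hs', authority_setAuthority_self, AuthorityState.history_handleConfirmation _ h,
      if_pos rfl]
    rfl
  have hn' : s'.nextSequence α C.value.sender = s.nextSequence α C.value.sender + 1 :=
    congrArg Prod.fst hhist'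
  have hp' : ((s'.authority α).account C.value.sender).pending = none :=
    congrArg (fun q => q.2.1) hhist'
  have hc' : s'.confirmed α C.value.sender = s.confirmed α C.value.sender ++ [C] :=
    congrArg (fun q => q.2.2) hhist'
  refine ⟨hs.signed_of_vote, ?_, ?_, hs.vote_unique, ?_, ?_, hs.reply⟩
  · intro β O hβ hO
    by_cases hne : β = α ∧ O.sender = C.value.sender
    · obtain ⟨rfl, hO'⟩ := hne
      left
      rw [hO', hn', ← hO']
      rcases hs.vote β O hβ hO with h1 | h1
      · omega
      · have := (hs.pending β _ O hβ h1).2.1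
        omega
    · rw [hn _ _ hne, hp _ _ hne]
      exact hs.vote β O hβ hO
  · intro β y O hβ hO
    by_cases hne : β = α ∧ y = C.value.sender
    · obtain ⟨rfl, rfl⟩ := hne
      rw [hp'] at hO
      cases hO
    · rw [hp _ _ hne] at hO
      rw [hn _ _ hne]
      exact hs.pending β y O hβ hO
  · intro β y hβ C' hC'
    by_cases hne : β = α ∧ y = C.value.sender
    · obtain ⟨rfl, rfl⟩ := hne
      rw [hc', List.mem_append, List.mem_singleton] at hC'
      rcases hC' with hC' | rfl
      · exact hs.confirmed β _ hβ C' hC'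
      · exact ⟨hC, rfl⟩
    · rw [hc _ _ hne] at hC'
      exact hs.confirmed β y hβ C' hC'
  · intro β y hβ
    by_cases hne : β = α ∧ y = C.value.sender
    · obtain ⟨rfl, rfl⟩ := hne
      have hseq : C.value.sequence = s.nextSequence β C.value.sender := h.symm
      rw [hc', hn', List.map_append, hs.map_sequence_confirmed β _ hβ, List.range_succ]
      simp [hseq]
    · rw [hc _ _ hne, hn _ _ hne]
      exact hs.map_sequence_confirmed β y hβ

/-- A new vote is cast for the current next number while nothing is pending. Every earlier vote for
that sender then has a smaller number, so no conflict arises; when `O` was already pending, the same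
vote is repeated. -/
lemma handleTransfer (hs : s.WellFormed sys) {α : A} {O : Order X P D} (hO : O ∈ s.signed)
    {a : AuthorityState A X P D} (ha : (s.authority α).Accepts O a) (p : X) :
    ({ s.setAuthority α a with
        votes := insert (α, O) s.votes
        replies := insert (p, α, O) s.replies } : GlobalState A X P D).WellFormed sys := by
  set s' : GlobalState A X P D := { s.setAuthority α a with
        votes := insert (α, O) s.votes
        replies := insert (p, α, O) s.replies } with hs'
  have hself : s'.authority α = a := authority_setAuthority_self s α a
  have hother : ∀ β ≠ α, s'.authority β = s.authority β := fun β hβ =>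
    authority_setAuthority_of_ne s hβ a
  have hn : ∀ β y, s'.nextSequence β y = s.nextSequence β y := by
    intro β y
    unfold GlobalState.nextSequence
    by_cases hβ : β = α
    · subst hβ; rw [hself, ha.nextSequence]
    · rw [hother β hβ]
  have hc : ∀ β y, s'.confirmed β y = s.confirmed β y := by
    intro β y
    unfold GlobalState.confirmed
    by_cases hβ : β = α
    · subst hβ; rw [hself, ha.confirmed]
    · rw [hother β hβ]
  have hp : ∀ β y, ¬ (β = α ∧ y = O.sender) →
      ((s'.authority β).account y).pending = ((s.authority β).account y).pending := by
    intro β y hne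
    by_cases hβ : β = α
    · subst hβ; rw [hself, ha.pending_of_ne _ fun hy => hne ⟨rfl, hy⟩]
    · rw [hother β hβ]
  have hp' : ((s'.authority α).account O.sender).pending = some O := by rw [hself, ha.pending]
  have hvotes : s.votes ⊆ s'.votes := Set.subset_insert _ _
  have hmem : ∀ β O', (β, O') ∈ s'.votes → (β = α ∧ O' = O) ∨ (β, O') ∈ s.votes := by
    intro β O' h
    rcases Set.mem_insert_iff.1 h with h | h
    · exact .inl (Prod.mk.inj h)
    · exact .inr h
  have hseq : sys.Honest α → O.sequence = s.nextSequence α O.sender := by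
    intro hα
    rcases ha.pending_or with h | h
    · exact (hs.pending α _ O hα h).2.1
    · exact h.2.symm
  -- An earlier vote is either outdated or for the pending order, and acceptance of `O` leaves only
  -- `O` as a possible pending order.
  have hold : ∀ O', sys.Honest α → (α, O') ∈ s.votes → O'.sender = O.sender →
      O'.sequence < s.nextSequence α O.sender ∨ O' = O := by
    intro O' hα hO' hsender
    rcases hs.vote α O' hα hO' with h | h
    · exact .inl (hsender ▸ h)
    · right
      rw [hsender] at h
      rcases ha.pending_or with h1 | h1
      · rw [h1] at h
        exact (Option.some.inj h).symm
      · rw [h1.1] at h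
        cases h
  refine ⟨?_, ?_, ?_, ?_, ?_, ?_, ?_⟩
  · intro β O' hβ h
    rcases hmem β O' h with ⟨-, rfl⟩ | h
    · exact hO
    · exact hs.signed_of_vote β O' hβ h
  · intro β O' hβ h
    rw [hn]
    rcases hmem β O' h with ⟨rfl, rfl⟩ | hvote
    · exact .inr hp'
    · by_cases hne : β = α ∧ O'.sender = O.sender
      · obtain ⟨rfl, hsender⟩ := hne
        rcases hold O' hβ hvote hsender with h1 | rfl
        · exact .inl (hsender.symm ▸ h1)
        · exact .inr hp'
      · rw [hp _ _ hne]
        exact hs.vote β O' hβ hvote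
  · intro β y O' hβ h
    rw [hn]
    by_cases hne : β = α ∧ y = O.sender
    · obtain ⟨rfl, rfl⟩ := hne
      rw [hp'] at h
      cases h
      exact ⟨rfl, hseq hβ, Set.mem_insert _ _⟩
    · rw [hp _ _ hne] at h
      obtain ⟨h1, h2, h3⟩ := hs.pending β y O' hβ h
      exact ⟨h1, h2, hvotes h3⟩
  · intro β O₁ O₂ hβ h1 h2 hsender hsequence
    rcases hmem β O₁ h1 with ⟨rfl, rfl⟩ | hv1 <;>
      rcases hmem β O₂ h2 with ⟨hβα, h2'⟩ | hv2
    · exact h2'.symm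
    · rcases hold O₂ hβ hv2 hsender.symm with h | h
      · have := hseq hβ
        omega
      · exact h.symm
    · subst hβα h2'
      rcases hold O₁ hβ hv1 hsender with h | h
      · have := hseq hβ
        omega
      · exact h
    · exact hs.vote_unique β O₁ O₂ hβ hv1 hv2 hsender hsequence
  · intro β y hβ C hC
    rw [hc] at hC
    exact ⟨(hs.confirmed β y hβ C hC).1.mono hvotes, (hs.confirmed β y hβ C hC).2⟩
  · intro β y hβ
    rw [hc, hn]
    exact hs.map_sequence_confirmed β y hβ
  · intro q β O' h
    rcases Set.mem_insert_iff.1 h with h | h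
    · obtain ⟨-, rfl, rfl⟩ : q = p ∧ β = α ∧ O' = O := by simpa using h
      exact Set.mem_insert _ _
    · exact hvotes (hs.reply q β O' h)

lemma step {e : Event A X P D} (hs : s.WellFormed sys) (h : Step sys s e s') :
    s'.WellFormed sys := by
  cases h with
  | idle => exact hs
  | fund T =>
    exact hs.of_history_eq subset_rfl subset_rfl (fun _ _ _ => id) (fun _ _ => rfl) hs.reply
  | sign O =>
    exact hs.of_history_eq (Set.subset_insert _ _) subset_rfl (fun _ _ _ => id) (fun _ _ => rfl)
      hs.reply
  | byzantineSign β O p hβ =>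
    refine hs.of_history_eq subset_rfl (Set.subset_insert _ _) ?_ (fun _ _ => rfl) ?_
    · intro γ O' hγ h
      rcases Set.mem_insert_iff.1 h with h | h
      · cases h
        exact absurd hγ hβ
      · exact h
    · intro q γ O' h
      rcases Set.mem_insert_iff.1 h with h | h
      · cases h
        exact Set.mem_insert _ _
      · exact Set.mem_insert_of_mem _ (hs.reply _ _ _ h)
  | send p α r =>
    exact hs.of_history_eq subset_rfl subset_rfl (fun _ _ _ => id) (fun _ _ => rfl) hs.reply
  | deliver p α r hα hr =>
    cases r with
    | synchronization S =>
      unfold handle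
      dsimp only
      split_ifs
      · exact hs.setAuthority fun y => AuthorityState.history_handleSynchronization _ _ _
      · exact hs
    | confirmation C =>
      unfold handle
      dsimp only
      split_ifs with hC
      · exact hs.handleConfirmation α hC
      · exact hs
    | transfer O =>
      unfold handle
      dsimp only
      split_ifs with hO
      · cases ha : (s.authority α).handleTransfer O with
        | none => exact hs
        | some a => exact hs.handleTransfer hO (AuthorityState.accepts_of_handleTransfer ha) p
      · exact hs
  | crossShard α C hα hC =>
    exact hs.setAuthority fun y => AuthorityState.history_handleCrossShard _ _ _
  | receive p α O h =>
    exact hs.of_history_eq subset_rfl subset_rfl (fun _ _ _ => id) (fun _ _ => rfl) hs.reply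

end WellFormed

end GlobalState

/-! ### Monotonicity of counters, votes and ledger -/

namespace AuthorityState

lemma nextSequence_le_handleConfirmation (shard : X → Sh) (s : AuthorityState A X P D)
    (C : Certificate A X P D) (y : X) :
    (s.account y).nextSequence ≤ ((s.handleConfirmation shard C).account y).nextSequence := by
  by_cases h : (s.account C.value.sender).nextSequence = C.value.sequence
  · have := congrArg Prod.fst (history_handleConfirmation shard h y)
    simp only [Account.history] at this
    rw [this]
    split_ifs
    · exact Nat.le_succ _
    · exact le_rfl
  · rw [handleConfirmation_of_ne shard h]

/-- Either the number of `C` is the expected one and the counter advances, or the counter is already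
past it and the order is ignored. The inequality in the hypothesis, rather than an equality,
tolerates confirmations caused by other clients. -/
lemma sequence_lt_handleConfirmation (shard : X → Sh) {s : AuthorityState A X P D}
    {C : Certificate A X P D}
    (h : C.value.sequence ≤ (s.account C.value.sender).nextSequence) :
    C.value.sequence <
      ((s.handleConfirmation shard C).account C.value.sender).nextSequence := by
  rcases h.lt_or_eq with h | h
  · exact h.trans_le (nextSequence_le_handleConfirmation shard s C _)
  · have := congrArg Prod.fst (history_handleConfirmation shard h.symm C.value.sender)
    rw [if_pos rfl] at this
    simp only [Account.history] at this
    omega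

end AuthorityState

namespace GlobalState

/-- The quantities that never decrease along a run. -/
structure Grows (s s' : GlobalState A X P D) : Prop where
  ledger : s.ledger <+: s'.ledger
  signed : s.signed ⊆ s'.signed
  votes : s.votes ⊆ s'.votes
  lastTransaction : ∀ β, (s.authority β).lastTransaction ≤ (s'.authority β).lastTransaction
  nextSequence : ∀ β y, s.nextSequence β y ≤ s'.nextSequence β y

lemma Grows.refl (s : GlobalState A X P D) : s.Grows s :=
  ⟨List.prefix_rfl, subset_rfl, subset_rfl, fun _ => le_rfl, fun _ _ => le_rfl⟩

lemma Grows.trans {s₁ s₂ s₃ : GlobalState A X P D} (h : s₁.Grows s₂) (h' : s₂.Grows s₃) :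
    s₁.Grows s₃ :=
  ⟨h.ledger.trans h'.ledger, h.signed.trans h'.signed, h.votes.trans h'.votes,
    fun β => (h.lastTransaction β).trans (h'.lastTransaction β),
    fun β y => (h.nextSequence β y).trans (h'.nextSequence β y)⟩

lemma grows_setAuthority (s : GlobalState A X P D) (α : A) (a : AuthorityState A X P D)
    (hl : (s.authority α).lastTransaction ≤ a.lastTransaction)
    (hn : ∀ y, ((s.authority α).account y).nextSequence ≤ (a.account y).nextSequence) :
    s.Grows (s.setAuthority α a) := by
  refine ⟨List.prefix_rfl, subset_rfl, subset_rfl, fun β => ?_, fun β y => ?_⟩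
  · by_cases hβ : β = α
    · subst hβ; rwa [authority_setAuthority_self]
    · rw [authority_setAuthority_of_ne _ hβ]
  · unfold GlobalState.nextSequence
    by_cases hβ : β = α
    · subst hβ; rw [authority_setAuthority_self]; exact hn y
    · rw [authority_setAuthority_of_ne _ hβ]

end GlobalState

lemma Step.grows [Fintype A] {sys : System A X Sh} {s s' : GlobalState A X P D}
    {e : Event A X P D} (h : Step sys s e s') : s.Grows s' := by
  cases h with
  | idle => exact .refl _
  | fund T =>
    exact ⟨List.prefix_append _ _, subset_rfl, subset_rfl, fun _ => le_rfl, fun _ _ => le_rfl⟩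
  | sign O =>
    exact ⟨List.prefix_rfl, Set.subset_insert _ _, subset_rfl, fun _ => le_rfl, fun _ _ => le_rfl⟩
  | byzantineSign β O p hβ =>
    exact ⟨List.prefix_rfl, subset_rfl, Set.subset_insert _ _, fun _ => le_rfl, fun _ _ => le_rfl⟩
  | send p α r =>
    exact ⟨List.prefix_rfl, subset_rfl, subset_rfl, fun _ => le_rfl, fun _ _ => le_rfl⟩
  | deliver p α r hα hr =>
    cases r with
    | synchronization S =>
      unfold GlobalState.handle
      dsimp only
      split_ifs
      · refine GlobalState.grows_setAuthority _ _ _ ?_ fun y => ?_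
        · rw [AuthorityState.lastTransaction_handleSynchronization]
          split_ifs <;> omega
        · exact (congrArg Prod.fst (AuthorityState.history_handleSynchronization _ S y)).ge
      · exact .refl _
    | confirmation C =>
      unfold GlobalState.handle
      dsimp only
      split_ifs with hC
      · exact GlobalState.grows_setAuthority _ _ _
          (AuthorityState.lastTransaction_handleConfirmation _ _ _).ge
          fun y => AuthorityState.nextSequence_le_handleConfirmation _ _ _ _
      · exact .refl _
    | transfer O =>
      unfold GlobalState.handle
      dsimp only
      split_ifs with hO
      · cases ha : (s.authority α).handleTransfer O with
        | none => exact .refl _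
        | some a =>
          have hacc := AuthorityState.accepts_of_handleTransfer ha
          have := GlobalState.grows_setAuthority s α a hacc.lastTransaction.ge
            fun y => (hacc.nextSequence y).ge
          exact ⟨this.ledger, this.signed, Set.subset_insert _ _, this.lastTransaction,
            this.nextSequence⟩
      · exact .refl _
  | crossShard α C hα hC =>
    exact GlobalState.grows_setAuthority _ _ _ (AuthorityState.lastTransaction_handleCrossShard _ _).ge
      fun y => (congrArg Prod.fst (AuthorityState.history_handleCrossShard _ C y)).ge
  | receive p α O h =>
    exact ⟨List.prefix_rfl, subset_rfl, subset_rfl, fun _ => le_rfl, fun _ _ => le_rfl⟩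

/-! ### Balance equation with a ghost multiset of credits -/

/-- The balance equation of the account `x` within an authority; `G` are the transfers with which
the account has been credited. -/
structure AuthorityState.Balanced (a : AuthorityState A X P D) (ledger : List (Funding X)) (x : X)
    (G : Multiset (Order X P D)) : Prop where
  lastTransaction_le : a.lastTransaction ≤ ledger.length
  balance : (a.account x).balance +
      (((a.account x).confirmed.map fun C => C.value.amount).sum : ℕ) =
    (funding x (ledger.take a.lastTransaction) : ℕ) + ((G.map Order.amount).sum : ℕ)
  credited : ∀ y, ∀ C ∈ (a.account y).confirmed, C.value.recipient = .fastPay x →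
    C.value ∈ G ∨ C ∈ a.crossShard

namespace AuthorityState.Balanced

variable {a : AuthorityState A X P D} {ledger : List (Funding X)} {x : X}
  {G : Multiset (Order X P D)}

lemma initial : (AuthorityState.initial : AuthorityState A X P D).Balanced [] x 0 := by
  constructor <;> simp [AuthorityState.initial, AuthorityState.account, Account.new, funding]

lemma ledger_append (h : a.Balanced ledger x G) (T : Funding X) :
    a.Balanced (ledger ++ [T]) x G := by
  refine ⟨h.lastTransaction_le.trans (by simp), ?_, h.credited⟩
  rw [List.take_append_of_le_length h.lastTransaction_le]
  exact h.balance

lemma accepts (h : a.Balanced ledger x G) {O : Order X P D} {a' : AuthorityState A X P D}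
    (ha : a.Accepts O a') : a'.Balanced ledger x G := by
  refine ⟨ha.lastTransaction.le.trans h.lastTransaction_le, ?_, ?_⟩
  · rw [ha.balance, ha.confirmed, ha.lastTransaction, h.balance]
  · intro y C hC hr
    rw [ha.confirmed] at hC
    rw [ha.crossShard]
    exact h.credited y C hC hr

lemma handleSynchronization (h : a.Balanced ledger x G) {S : SyncOrder X}
    (hS : S ∈ syncOrders ledger) : (a.handleSynchronization S).Balanced ledger x G := by
  classical
  by_cases hi : S.index = a.lastTransaction + 1
  swap
  · rwa [AuthorityState.handleSynchronization, if_neg hi]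
  have hc : ∀ y, ((a.handleSynchronization S).account y).confirmed = (a.account y).confirmed :=
    fun y => (Account.history_eq_iff.1 (history_handleSynchronization a S y)).2.2
  obtain ⟨i, hlt, rfl⟩ := mem_syncOrders.1 hS
  -- Indices start at 1 and positions at 0, so the accepted transaction is the first one beyond the
  -- processed prefix.
  obtain rfl : i = a.lastTransaction := by simpa using hi
  have hl := lastTransaction_handleSynchronization a
    ⟨a.lastTransaction + 1, ledger[a.lastTransaction].recipient, ledger[a.lastTransaction].amount⟩
  rw [if_pos rfl] at hl
  refine ⟨by rw [hl]; exact hlt, ?_, ?_⟩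
  · rw [hc, hl, balance_handleSynchronization rfl, funding_take_succ x ledger _ hlt]
    have := h.balance
    split_ifs <;> push_cast at this ⊢ <;> linarith
  · intro y C hC hr
    rw [hc] at hC
    rw [crossShard_handleSynchronization]
    exact h.credited y C hC hr

lemma handleCrossShard (h : a.Balanced ledger x G) (C : Certificate A X P D) :
    ∃ G', G ≤ G' ∧ (a.handleCrossShard C).Balanced ledger x G' ∧
      (C.value.recipient = .fastPay x → C.value ∈ G') := by
  classical
  have hc : ∀ y, ((a.handleCrossShard C).account y).confirmed = (a.account y).confirmed :=
    fun y => (Account.history_eq_iff.1 (history_handleCrossShard a C y)).2.2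
  have hbal := h.balance
  by_cases hr : C.value.recipient = .fastPay x
  · refine ⟨C.value ::ₘ G, Multiset.le_cons_self _ _, ⟨?_, ?_, ?_⟩, by simp⟩
    · rw [lastTransaction_handleCrossShard]; exact h.lastTransaction_le
    · rw [hc, balance_handleCrossShard, if_pos hr, lastTransaction_handleCrossShard,
        Multiset.map_cons, Multiset.sum_cons]
      push_cast at hbal ⊢
      linarith
    · intro y C' hC' hr'
      rw [hc] at hC'
      rw [crossShard_handleCrossShard]
      -- `erase` removes a copy of `C`, so only the other certificates are sure to remain queued;
      -- the order of `C` has just entered the multiset.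
      by_cases hCC : C' = C
      · exact .inl (hCC ▸ Multiset.mem_cons_self _ _)
      · exact (h.credited y C' hC' hr').imp Multiset.mem_cons_of_mem
          (Multiset.mem_erase_of_ne hCC).2
  · refine ⟨G, le_rfl, ⟨?_, ?_, ?_⟩, fun h' => absurd h' hr⟩
    · rw [lastTransaction_handleCrossShard]; exact h.lastTransaction_le
    · rw [hc, balance_handleCrossShard, if_neg hr, lastTransaction_handleCrossShard, add_zero]
      exact hbal
    · intro y C' hC' hr'
      rw [hc] at hC'
      rw [crossShard_handleCrossShard]
      refine (h.credited y C' hC' hr').imp id (Multiset.mem_erase_of_ne ?_).2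
      rintro rfl
      exact hr hr'

/-- The debit moves an amount from the balance to the confirmed total, which keeps their sum. A
credit to `x` within the same shard enlarges the multiset; one to another shard only enters the
queue and leaves the equation alone. -/
lemma handleConfirmation (h : a.Balanced ledger x G) (shard : X → Sh) (C : Certificate A X P D) :
    ∃ G', G ≤ G' ∧ (a.handleConfirmation shard C).Balanced ledger x G' := by
  classical
  by_cases hn : (a.account C.value.sender).nextSequence = C.value.sequence
  swap
  · rw [handleConfirmation_of_ne shard hn]
    exact ⟨G, le_rfl, h⟩
  have hc : ∀ y, ((a.handleConfirmation shard C).account y).confirmed =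
      if y = C.value.sender then (a.account y).confirmed ++ [C] else (a.account y).confirmed := by
    intro y
    have := congrArg (fun q => q.2.2) (history_handleConfirmation shard hn y)
    simp only [Account.history] at this
    rw [this]
    split_ifs <;> rfl
  have hcross := Multiset.subset_of_le (crossShard_le_handleConfirmation shard a C)
  have hlast := lastTransaction_handleConfirmation shard a C
  have hbal := h.balance
  have hmem : ∀ y, ∀ C' ∈ ((a.handleConfirmation shard C).account y).confirmed,
      C' = C ∨ C' ∈ (a.account y).confirmed := by
    intro y C' hC'
    rw [hc] at hC'
    split_ifs at hC'
    · rw [List.mem_append, List.mem_singleton] at hC'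
      exact hC'.symm
    · exact .inr hC'
  have hsum : (((a.handleConfirmation shard C).account x).confirmed.map
        fun C => C.value.amount).sum =
      ((a.account x).confirmed.map fun C => C.value.amount).sum +
        if x = C.value.sender then C.value.amount else 0 := by
    rw [hc]
    split_ifs <;> simp
  by_cases hr : C.value.recipient = .fastPay x ∧ shard x = shard C.value.sender
  · refine ⟨C.value ::ₘ G, Multiset.le_cons_self _ _, hlast.le.trans h.lastTransaction_le, ?_, ?_⟩
    · rw [hsum, hlast, balance_handleConfirmation shard hn, if_pos hr, Multiset.map_cons,
        Multiset.sum_cons]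
      split_ifs <;> push_cast at hbal ⊢ <;> linarith
    · intro y C' hC' hr'
      rcases hmem y C' hC' with rfl | hC'
      · exact .inl (Multiset.mem_cons_self _ _)
      · exact (h.credited y C' hC' hr').imp Multiset.mem_cons_of_mem fun h => hcross h
  · refine ⟨G, le_rfl, hlast.le.trans h.lastTransaction_le, ?_, ?_⟩
    · rw [hsum, hlast, balance_handleConfirmation shard hn, if_neg hr]
      split_ifs <;> push_cast at hbal ⊢ <;> linarith
    · intro y C' hC' hr'
      rcases hmem y C' hC' with rfl | hC'
      · exact .inr (mem_crossShard_handleConfirmation shard hn hr' fun hsh => hr ⟨hr', hsh⟩)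
      · exact (h.credited y C' hC' hr').imp id fun h => hcross h

end AuthorityState.Balanced

/-- The multiset is not a function of the state, so it can only be prolonged step by step. The last
clause is what turns delivery of a cross-shard update into membership. -/
lemma Step.exists_balanced [Fintype A] {sys : System A X Sh} {s s' : GlobalState A X P D}
    {e : Event A X P D} (h : Step sys s e s') {α : A} {x : X} {G : Multiset (Order X P D)}
    (hG : (s.authority α).Balanced s.ledger x G) :
    ∃ G', G ≤ G' ∧ (s'.authority α).Balanced s'.ledger x G' ∧
      ∀ C, e = .crossShard α C → C.value.recipient = .fastPay x → C.value ∈ G' := by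
  have set_ne : ∀ β a, β ≠ α →
      ((s.setAuthority β a).authority α).Balanced s.ledger x G := fun β a hβ => by
    rwa [GlobalState.authority_setAuthority_of_ne _ hβ.symm]
  cases h with
  | idle => exact ⟨G, le_rfl, hG, nofun⟩
  | fund T => exact ⟨G, le_rfl, hG.ledger_append T, nofun⟩
  | sign O => exact ⟨G, le_rfl, hG, nofun⟩
  | byzantineSign β O p hβ => exact ⟨G, le_rfl, hG, nofun⟩
  | send p β r => exact ⟨G, le_rfl, hG, nofun⟩
  | receive p β O h => exact ⟨G, le_rfl, hG, nofun⟩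
  | crossShard β C hβ hC =>
    by_cases hne : β = α
    · subst hne
      obtain ⟨G', hle, hG', hmem⟩ := hG.handleCrossShard C
      refine ⟨G', hle, ?_, ?_⟩
      · rw [GlobalState.authority_setAuthority_self]; exact hG'
      · rintro C' hC' hr
        cases hC'
        exact hmem hr
    · refine ⟨G, le_rfl, set_ne _ _ hne, ?_⟩
      intro C' hC'
      cases hC'
      exact absurd rfl hne
  | deliver p β r hβ hr =>
    suffices ∃ G', G ≤ G' ∧ ((s.handle sys p β r).authority α).Balanced
        (s.handle sys p β r).ledger x G' by
      obtain ⟨G', h1, h2⟩ := this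
      exact ⟨G', h1, h2, nofun⟩
    cases r with
    | synchronization S =>
      unfold GlobalState.handle
      dsimp only
      split_ifs with hS
      · refine ⟨G, le_rfl, ?_⟩
        by_cases hne : β = α
        · subst hne
          rw [GlobalState.authority_setAuthority_self]
          exact hG.handleSynchronization hS
        · exact set_ne _ _ hne
      · exact ⟨G, le_rfl, hG⟩
    | confirmation C =>
      unfold GlobalState.handle
      dsimp only
      split_ifs with hC
      · by_cases hne : β = α
        · subst hne
          rw [GlobalState.authority_setAuthority_self]
          exact hG.handleConfirmation _ C
        · exact ⟨G, le_rfl, set_ne _ _ hne⟩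
      · exact ⟨G, le_rfl, hG⟩
    | transfer O =>
      unfold GlobalState.handle
      dsimp only
      split_ifs with hO
      · cases ha : (s.authority β).handleTransfer O with
        | none => exact ⟨G, le_rfl, hG⟩
        | some a =>
          refine ⟨G, le_rfl, ?_⟩
          by_cases hne : β = α
          · subst hne
            refine Eq.subst (motive := fun b => AuthorityState.Balanced b s.ledger x G)
              (GlobalState.authority_setAuthority_self s β a).symm ?_
            exact hG.accepts (AuthorityState.accepts_of_handleTransfer ha)
          · exact set_ne _ _ hne
      · exact ⟨G, le_rfl, hG⟩

/-- The set counts an order once even if several certificates carry it, whereas `G` may contain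
repetitions and other credits. Only this inequality is needed to bound the balance from below. -/
lemma finsum_amount_le_sum {L : List (Certificate A X P D)}
    {G : Multiset (Order X P D)} (h : ∀ C ∈ L, C.value ∈ G) :
    ∑ᶠ O ∈ {O : Order X P D | ∃ C ∈ L, C.value = O}, O.amount ≤ (G.map Order.amount).sum := by
  classical
  have hset : {O : Order X P D | ∃ C ∈ L, C.value = O} =
      ((L.map Certificate.value).toFinset : Set (Order X P D)) := by
    ext O; simp
  rw [hset, finsum_mem_coe_finset]
  -- Since duplicates have been removed, inclusion of elements gives inclusion of multisets.
  have hle : (L.map Certificate.value).toFinset.val ≤ G := by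
    refine (Multiset.le_iff_subset (L.map Certificate.value).toFinset.nodup).2 fun O hO => ?_
    obtain ⟨C, hC, rfl⟩ := List.mem_map.1 (List.mem_toFinset.1 hO)
    exact h C hC
  obtain ⟨K, rfl⟩ := Multiset.le_iff_exists_add.1 hle
  rw [Multiset.map_add, Multiset.sum_add]
  exact Nat.le_add_right _ _

/-! ### Invariants along a run, and uniqueness of the orders of a correct user -/

namespace Run

variable [Fintype A] {sys : System A X Sh} (R : Run P D sys)

lemma wellFormed (t : ℕ) : (R.state t).WellFormed sys := by
  induction t with
  | zero => rw [R.state_zero]; exact .initial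
  | succ t ih => exact ih.step (R.step t)

lemma grows {t t' : ℕ} (h : t ≤ t') : (R.state t).Grows (R.state t') := by
  induction t', h using Nat.le_induction with
  | base => exact .refl _
  | succ t' _ ih => exact ih.trans (R.step t').grows

/-- The transfers with which the account `x` has been credited by `α` over time. -/
lemma exists_credits (α : A) (x : X) : ∃ G : ℕ → Multiset (Order X P D), Monotone G ∧
    (∀ t, ((R.state t).authority α).Balanced (R.state t).ledger x (G t)) ∧
    ∀ t C, R.event t = .crossShard α C → C.value.recipient = .fastPay x →
      C.value ∈ G (t + 1) := by
  -- `f` prolongs the ghost multiset by one step; iterating it from the empty multiset gives the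
  -- whole history of credits.
  choose! f hle hbal hmem using fun t (G : Multiset (Order X P D)) =>
    (R.step t).exists_balanced (α := α) (x := x) (G := G)
  let G : ℕ → Multiset (Order X P D) := fun t => Nat.rec 0 f t
  have hG : ∀ t, ((R.state t).authority α).Balanced (R.state t).ledger x (G t) := by
    intro t
    induction t with
    | zero => rw [R.state_zero]; exact .initial
    | succ t ih => exact hbal t _ ih
  exact ⟨G, monotone_nat_of_le_succ fun t => hle t _ (hG t), hG,
    fun t C => hmem t _ (hG t) C⟩

variable {R}

lemma state_of_deliver {t : ℕ} {p : X} {α : A} {r : Request A X P D}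
    (h : R.event t = .deliver p α r) : R.state (t + 1) = (R.state t).handle sys p α r := by
  have := R.step t
  rw [h] at this
  generalize R.state t = s, R.state (t + 1) = s' at this
  cases this
  rfl

lemma state_of_sign {t : ℕ} {O : Order X P D} (h : R.event t = .sign O) :
    R.state (t + 1) = { R.state t with signed := insert O (R.state t).signed } := by
  have := R.step t
  rw [h] at this
  generalize R.state t = s, R.state (t + 1) = s' at this
  cases this
  rfl

lemma mem_obtained_of_receive {t : ℕ} {p : X} {α : A} {O : Order X P D}
    (h : R.event t = .receive p α O) : (p, α, O) ∈ (R.state (t + 1)).obtained := by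
  have := R.step t
  rw [h] at this
  generalize R.state t = s, R.state (t + 1) = s' at this
  cases this
  exact Set.mem_insert _ _

lemma signed_succ_subset (t : ℕ) (O : Order X P D) (hO : O ∈ (R.state (t + 1)).signed) :
    O ∈ (R.state t).signed ∨ R.event t = .sign O := by
  have := R.step t
  generalize R.state t = s, R.state (t + 1) = s', R.event t = e at this hO
  cases this with
  | idle | fund | byzantineSign | send | crossShard | receive => exact .inl hO
  | sign O' =>
    rcases Set.mem_insert_iff.1 hO with h | h
    · exact .inr (h ▸ rfl)
    · exact .inl h
  | deliver p α r hα hr =>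
    left
    cases r <;> simp only [GlobalState.handle] at hO <;> split_ifs at hO
    all_goals try exact hO
    split at hO <;> exact hO

/-- A correct user never signs two transfer orders with the same sequence number. -/
lemma CorrectUser.signed_unique {x : X} (hx : R.CorrectUser x) (t : ℕ) {O O' : Order X P D}
    (hO : O ∈ (R.state t).signed) (hO' : O' ∈ (R.state t).signed) (hsender : O.sender = x)
    (hsender' : O'.sender = x) (hseq : O.sequence = O'.sequence) : O = O' := by
  induction t with
  | zero => rw [R.state_zero] at hO; exact hO.elim
  | succ t ih =>
    rcases signed_succ_subset t O hO with h | h <;> rcases signed_succ_subset t O' hO' with h' | h'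
    · exact ih h h'
    · have := (hx.sequence t O' h' hsender' O.sequence).1 ⟨O, h, hsender, rfl⟩
      omega
    · have := (hx.sequence t O h hsender O'.sequence).1 ⟨O', h', hsender', rfl⟩
      omega
    · rw [h] at h'
      cases h'
      rfl

/-! ### What the transmissions of the user achieve at the authority -/

lemma Transmits.le {p : X} {α : A} {L : List (Request A X P D)} {t t' : ℕ}
    (h : R.Transmits p α L t t') : t ≤ t' := by
  induction h with
  | nil => exact le_rfl
  | cons => omega

lemma lastTransaction_of_deliver {t : ℕ} {p : X} {α : A} {S : SyncOrder X}
    (h : R.event t = .deliver p α (.synchronization S)) (hS : S ∈ syncOrders (R.state t).ledger)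
    (hi : S.index ≤ ((R.state t).authority α).lastTransaction + 1) :
    S.index ≤ ((R.state (t + 1)).authority α).lastTransaction := by
  rw [state_of_deliver h]
  simp only [GlobalState.handle, if_pos hS, GlobalState.authority_setAuthority_self,
    AuthorityState.lastTransaction_handleSynchronization]
  split_ifs <;> omega

lemma nextSequence_of_deliver {t : ℕ} {p : X} {α : A} {C : Certificate A X P D}
    (h : R.event t = .deliver p α (.confirmation C)) (hC : (R.state t).Valid sys C)
    (hi : C.value.sequence ≤ (R.state t).nextSequence α C.value.sender) :
    C.value.sequence < (R.state (t + 1)).nextSequence α C.value.sender := by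
  rw [state_of_deliver h]
  simp only [GlobalState.handle, if_pos hC, GlobalState.nextSequence,
    GlobalState.authority_setAuthority_self]
  exact AuthorityState.sequence_lt_handleConfirmation _ hi

/-- Each delivery raises the guaranteed lower bound `j` by one. The counter itself may run ahead,
since other clients also synchronize `α`; orders that have become stale do no harm. -/
lemma Transmits.add_length_le_lastTransaction {p : X} {α : A} {L : List (SyncOrder X)}
    {t t' j : ℕ} (h : R.Transmits p α (L.map .synchronization) t t')
    (hL : ∀ S ∈ L, S ∈ syncOrders (R.state t).ledger)
    (hindex : L.map SyncOrder.index = List.range' (j + 1) L.length)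
    (hj : j ≤ ((R.state t).authority α).lastTransaction) :
    j + L.length ≤ ((R.state t').authority α).lastTransaction := by
  induction L generalizing t j with
  | nil => cases h; exact hj
  | cons S L ih =>
    rw [List.map_cons] at h
    cases h with
    | cons _ _ _ u v _ htu hu huv hv hrest =>
      rw [List.map_cons, List.length_cons, List.range'_succ, List.cons.injEq] at hindex
      have hgrows := R.grows (htu.trans huv.le)
      have hlast := hgrows.lastTransaction α
      have hS := syncOrders_subset hgrows.ledger (hL S List.mem_cons_self)
      have hdeliver := lastTransaction_of_deliver hv hS (by omega)
      have := ih hrest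
        (fun S' hS' => syncOrders_subset (R.grows (by omega : t ≤ v + 1)).ledger
          (hL S' (List.mem_cons_of_mem _ hS'))) hindex.2 (by omega)
      rw [List.length_cons]
      omega

/-- Same induction on a lower bound, with confirmations by other clients as the possible
interference. Validity of the certificates persists because votes are never withdrawn. -/
lemma Transmits.add_length_le_nextSequence {p : X} {α : A} {y : X}
    {L : List (Certificate A X P D)} {t t' j : ℕ}
    (h : R.Transmits p α (L.map .confirmation) t t')
    (hL : ∀ C ∈ L, (R.state t).Valid sys C ∧ C.value.sender = y)
    (hsequence : L.map (fun C => C.value.sequence) = List.range' j L.length)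
    (hj : j ≤ (R.state t).nextSequence α y) :
    j + L.length ≤ (R.state t').nextSequence α y := by
  induction L generalizing t j with
  | nil => cases h; exact hj
  | cons C L ih =>
    rw [List.map_cons] at h
    cases h with
    | cons _ _ _ u v _ htu hu huv hv hrest =>
      rw [List.map_cons, List.length_cons, List.range'_succ, List.cons.injEq] at hsequence
      have hgrows := R.grows (htu.trans huv.le)
      have hnext := hgrows.nextSequence α y
      obtain ⟨hC, rfl⟩ := hL C List.mem_cons_self
      have hdeliver := nextSequence_of_deliver hv (hC.mono hgrows.votes) (by omega)
      have := ih hrest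
        (fun C' hC' => ⟨(hL C' (List.mem_cons_of_mem _ hC')).1.mono
          (R.grows (by omega : t ≤ v + 1)).votes, (hL C' (List.mem_cons_of_mem _ hC')).2⟩)
        hsequence.2 (by omega)
      rw [List.length_cons]
      omega

lemma Synchronizes.le {p : X} {α : A} {σ : List (Funding X)} {t t' : ℕ}
    (h : R.Synchronizes p α σ t t') : t ≤ t' := by
  obtain ⟨u, hu, k, -, hT⟩ := h
  exact hu.trans hT.le

lemma Synchronizes.length_le {p : X} {α : A} {σ : List (Funding X)} {t t' : ℕ}
    (h : R.Synchronizes p α σ t t') (hσ : σ <+: (R.state t).ledger) :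
    σ.length ≤ ((R.state t').authority α).lastTransaction := by
  obtain ⟨u, hu, k, hk, hT⟩ := h
  have := hT.add_length_le_lastTransaction
    (fun S hS => syncOrders_subset (hσ.trans (R.grows hu).ledger) (List.mem_of_mem_drop hS))
    (by simp [map_index_syncOrders, List.drop_range', length_syncOrders, add_comm]) hk
  rw [List.length_drop, length_syncOrders] at this
  omega

lemma SendsMissing.le {p : X} {α : A} {y : X} {m : ℕ} {next : List (Request A X P D)} {t t' : ℕ}
    (h : R.SendsMissing p α y m next t t') : t ≤ t' := by
  obtain ⟨u, hu, k, -, L, -, hT⟩ := h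
  exact hu.trans hT.le

lemma IsCertificateChain.length_eq {t k m : ℕ} {y : X} {L : List (Certificate A X P D)}
    (h : R.IsCertificateChain t y k m L) : L.length = m - k := by
  simpa using congrArg List.length h.2

lemma SendsMissing.le_nextSequence {p : X} {α : A} {y : X} {m : ℕ} {t t' : ℕ}
    (h : R.SendsMissing p α y m [] t t') : m ≤ (R.state t').nextSequence α y := by
  obtain ⟨u, hu, k, hk, L, hL, hT⟩ := h
  rw [List.append_nil] at hT
  have := hT.add_length_le_nextSequence hL.1 (by rw [hL.2, hL.length_eq]) hk
  rw [hL.length_eq] at this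
  -- With truncated subtraction, `k + (m - k)` is the maximum of `k` and `m`, so the case where
  -- nothing is missing needs no separate treatment.
  omega

lemma SendsMissing.sequence_lt {p : X} {α : A} {C : Certificate A X P D} {t t' : ℕ}
    (h : R.SendsMissing p α C.value.sender C.value.sequence [.confirmation C] t t')
    (hC : (R.state t).Valid sys C) :
    C.value.sequence < (R.state t').nextSequence α C.value.sender := by
  obtain ⟨u, hu, k, hk, L, hL, hT⟩ := h
  have hlen := hL.length_eq
  -- If `k` is at most the number of `C`, appending `C` to the chain gives consecutive numbers from
  -- `k` through that of `C`. Otherwise `α` was past `C` before the transmission began, and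
  -- monotonicity is enough.
  rcases le_or_gt k C.value.sequence with hkC | hkC
  · have hT' : R.Transmits p α ((L ++ [C]).map .confirmation) u t' := by simpa using hT
    have := hT'.add_length_le_nextSequence (j := k) (y := C.value.sender) ?_ ?_ hk
    · rw [List.length_append, List.length_singleton] at this
      omega
    · intro C' hC'
      rw [List.mem_append, List.mem_singleton] at hC'
      rcases hC' with hC' | rfl
      · exact hL.1 C' hC'
      · exact ⟨hC.mono (R.grows hu).votes, rfl⟩
    · rw [List.map_append, hL.2, List.length_append, hlen, List.length_singleton,
        List.range'_1_concat]
      simp only [List.map_cons, List.map_nil]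
      congr 2
      omega
  · exact hkC.trans_le (hk.trans ((R.grows hT.le).nextSequence α _))

lemma Confirms.le {p : X} {α : A} {L : List (Certificate A X P D)} {t t' : ℕ}
    (h : R.Confirms p α L t t') : t ≤ t' := by
  induction h with
  | nil => exact le_rfl
  | cons C L t u t' hC _ ih => exact hC.le.trans ih

lemma Confirms.sequence_lt {p : X} {α : A} {L : List (Certificate A X P D)} {t t' : ℕ}
    (h : R.Confirms p α L t t') (hL : ∀ C ∈ L, (R.state t).Valid sys C) :
    ∀ C ∈ L, C.value.sequence < (R.state t').nextSequence α C.value.sender := by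
  induction h with
  | nil => simp
  | cons C L t u t' hC hrest ih =>
    intro C' hC'
    rcases List.mem_cons.1 hC' with rfl | hC'
    · exact (hC.sequence_lt (hL C' List.mem_cons_self)).trans_le
        ((R.grows hrest.le).nextSequence α _)
    · exact ih (fun C'' h'' => (hL C'' (List.mem_cons_of_mem _ h'')).mono (R.grows hC.le).votes)
        C' hC'

/-! ### Money eventually credited and money spent -/

/-- A confirmed certificate with recipient `x` is eventually credited. -/
lemma Fair.eventually_mem_credits (hfair : R.Fair) {α : A} (hα : sys.Honest α) {x : X}
    {G : ℕ → Multiset (Order X P D)} (hmono : Monotone G)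
    (hG : ∀ t, ((R.state t).authority α).Balanced (R.state t).ledger x (G t))
    (hcross : ∀ t C, R.event t = .crossShard α C → C.value.recipient = .fastPay x →
      C.value ∈ G (t + 1))
    {C : Certificate A X P D} {t : ℕ} (hC : (R.state t).Valid sys C)
    (hr : C.value.recipient = .fastPay x)
    (hlt : C.value.sequence < (R.state t).nextSequence α C.value.sender) :
    ∀ᶠ u in Filter.atTop, C.value ∈ G u := by
  obtain ⟨C', hC', hseq⟩ := (R.wellFormed t).exists_confirmed hα hlt
  obtain ⟨hvalid, hsender⟩ := (R.wellFormed t).confirmed α _ hα C' hC'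
  -- `α` may have confirmed another certificate than `C`, with different signers. Both certify the
  -- same order, which is why credits are recorded as orders.
  have hval : C'.value = C.value := (R.wellFormed t).value_unique hvalid hC hsender hseq
  suffices ∃ u, C.value ∈ G u by
    obtain ⟨u, hu⟩ := this
    exact Filter.eventually_atTop.2 ⟨u, fun v hv => Multiset.mem_of_le (hmono hv) hu⟩
  rw [← hval] at hr ⊢
  rcases (hG t).credited _ C' hC' hr with h | h
  · exact ⟨t, h⟩
  · obtain ⟨u, -, hu⟩ := hfair.crossShard t α C' hα h
    exact ⟨u + 1, hcross u C' hu hr⟩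

/-- The amounts confirmed by an honest authority from the account of a correct user whose next
sequence number there is that of a new order are certified when this order is signed. -/
lemma CorrectUser.sum_confirmed_le {x : X} (hx : R.CorrectUser x) {t₀ t : ℕ} {O : Order X P D}
    (hO : R.event t₀ = .sign O) (hsender : O.sender = x) {α : A} (hα : sys.Honest α)
    (ht : t₀ ≤ t) (hn : (R.state t).nextSequence α x = O.sequence) :
    (((R.state t).confirmed α x).map fun C => C.value.amount).sum ≤
      ∑ᶠ O' ∈ {O' : Order X P D | (R.state t₀).Certified sys O' ∧ O'.sender = x ∧
        O'.sequence < O.sequence}, O'.amount := by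
  classical
  set S := {O' : Order X P D | (R.state t₀).Certified sys O' ∧ O'.sender = x ∧
        O'.sequence < O.sequence} with hS
  have hsigned : ∀ O' ∈ S, O' ∈ (R.state t₀).signed := by
    rintro O' ⟨⟨C, hC, rfl⟩, -⟩
    exact (R.wellFormed t₀).signed_of_valid hC
  -- A correct user signs one order per number, so the number embeds `S` into a finite interval.
  -- Without finiteness the `finsum` could take the default value 0 and bound nothing.
  have hfin : S.Finite := by
    refine Set.Finite.of_injOn (f := Order.sequence) (t := Set.Iio O.sequence)
      (fun O' h => h.2.2) ?_ (Set.finite_Iio _)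
    intro O₁ h1 O₂ h2 heq
    exact hx.signed_unique t₀ (hsigned _ h1) (hsigned _ h2) h1.2.1 h2.2.1 heq
  rw [finsum_mem_eq_finite_toFinset_sum _ hfin]
  have hseq := (R.wellFormed t).map_sequence_confirmed α x hα
  set L := ((R.state t).confirmed α x).map Certificate.value with hL
  have hLseq : L.map Order.sequence = List.range O.sequence := by
    rw [hL, List.map_map, ← hn, ← hseq]
    rfl
  have hnodup : L.Nodup := List.Nodup.of_map Order.sequence (hLseq ▸ List.nodup_range)
  have hmem : ∀ O' ∈ L, O' ∈ S := by
    intro O' hO'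
    have hlt : O'.sequence < O.sequence := by
      rw [← List.mem_range, ← hLseq]
      exact List.mem_map_of_mem hO'
    obtain ⟨C, hC, rfl⟩ := List.mem_map.1 hO'
    obtain ⟨hvalid, hCx⟩ := (R.wellFormed t).confirmed α x hα C hC
    -- The certificate that `α` holds may have been formed after `t₀`. However, an order with its
    -- number was already signed at `t₀`; by uniqueness it is the same order, and the user had a
    -- certificate of it when signing `O`.
    obtain ⟨O'', h1, h2, h3⟩ := (hx.sequence t₀ O hO hsender C.value.sequence).2 hlt
    obtain rfl : O'' = C.value := hx.signed_unique t ((R.grows ht).signed h1)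
      ((R.wellFormed t).signed_of_valid hvalid) h2 hCx h3
    exact ⟨hx.certified t₀ O hO hsender _ h1 h2, hCx, hlt⟩
  calc (((R.state t).confirmed α x).map fun C => C.value.amount).sum
      = (L.map Order.amount).sum := by rw [hL, List.map_map]; rfl
    _ = ∑ O' ∈ L.toFinset, O'.amount := (List.sum_toFinset _ hnodup).symm
    _ ≤ ∑ O' ∈ hfin.toFinset, O'.amount := by
      refine Finset.sum_le_sum_of_subset ?_
      intro O' hO'
      exact hfin.mem_toFinset.2 (hmem O' (List.mem_toFinset.1 hO'))

lemma mem_replies_of_deliver {t : ℕ} {p : X} {α : A} {O : Order X P D}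
    (h : R.event t = .deliver p α (.transfer O)) (hO : O ∈ (R.state t).signed)
    (hacc : ∃ a, ((R.state t).authority α).handleTransfer O = some a) :
    (p, α, O) ∈ (R.state (t + 1)).replies := by
  obtain ⟨a, ha⟩ := hacc
  rw [state_of_deliver h]
  simp only [GlobalState.handle, if_pos hO, ha]
  exact Set.mem_insert _ _

lemma exists_mem_replies_of_mem_obtained {p : X} {α : A} {O : Order X P D} {t : ℕ}
    (h : (p, α, O) ∈ (R.state t).obtained) : ∃ u, (p, α, O) ∈ (R.state u).replies := by
  induction t with
  | zero => rw [R.state_zero] at h; exact h.elim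
  | succ t ih =>
    suffices (p, α, O) ∈ (R.state t).obtained ∨ (p, α, O) ∈ (R.state t).replies from
      this.elim ih fun h => ⟨t, h⟩
    have := R.step t
    generalize R.state t = s, R.state (t + 1) = s', R.event t = e at this h
    cases this with
    | idle | fund | byzantineSign | send | crossShard | sign => exact .inl h
    | receive q β O' hr =>
      rcases Set.mem_insert_iff.1 h with h | h
      · exact .inr (h ▸ hr)
      · exact .inl h
    | deliver q β r hβ hr =>
      left
      cases r <;> simp only [GlobalState.handle] at h <;> split_ifs at h
      all_goals try exact h
      split at h <;> exact h

lemma Fair.obtains (hfair : R.Fair) {α : A} (hα : sys.Honest α) {p : X} {O : Order X P D} {t : ℕ}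
    (h : (p, α, O) ∈ (R.state t).replies) :
    ∃ u, (p, α, O) ∈ (R.state u).obtained ∧ (α, O) ∈ (R.state u).votes := by
  obtain ⟨u, hu, hrec⟩ := hfair.reply t p α O hα h
  exact ⟨u + 1, mem_obtained_of_receive hrec,
    (R.grows (by omega : t ≤ u + 1)).votes ((R.wellFormed t).reply p α O h)⟩

end Run

end FastPay

/-! ### The availability theorem -/

theorem mainTheorem5 {A X P D Sh : Type*} [Fintype A] (sys : FastPay.System A X Sh)
    (R : FastPay.Run P D sys) (hfair : R.Fair)
    (x : X) (hx : R.CorrectUser x)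
    (t₀ n : ℕ) (O : FastPay.Order X P D) (hO : R.event t₀ = .sign O)
    (hsender : O.sender = x) (hsequence : O.sequence = n) (hamount : 0 < O.amount)
    (σ : List (FastPay.Funding X)) (hσ : σ <+: (R.state t₀).ledger)
    (received : List (FastPay.Certificate A X P D))
    (hreceived : ∀ C ∈ received,
      (R.state t₀).Valid sys C ∧ C.value.recipient = .fastPay x)
    (hfunds :
      O.amount +
          ∑ᶠ O' ∈ {O' : FastPay.Order X P D |
            (R.state t₀).Certified sys O' ∧ O'.sender = x ∧ O'.sequence < n}, O'.amount ≤
        FastPay.funding x σ +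
          ∑ᶠ O' ∈ {O' : FastPay.Order X P D | ∃ C ∈ received, C.value = O'}, O'.amount)
    (α : A) (hα : sys.Honest α) (t₁ t₂ t₃ : ℕ)
    (h₁ : R.Synchronizes x α σ (t₀ + 1) t₁)
    (h₂ : R.Confirms x α received t₁ t₂)
    (h₃ : R.SendsMissing x α x n [] t₂ t₃)
    (h₄ : R.KeepsSending x α O t₃) :
    (∃ t, (x, α, O) ∈ (R.state t).obtained ∧ (α, O) ∈ (R.state t).votes) ∨
      (∃ t, (x, α, O) ∉ (R.state t).replies ∧
        ∃ C ∈ (R.state t).confirmed α x, C.value = O) := by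
  subst hsequence
  by_cases hrep : ∃ t, (x, α, O) ∈ (R.state t).replies
  · obtain ⟨t, ht⟩ := hrep
    exact .inl (hfair.obtains hα ht)
  push Not at hrep
  right
  have hstart : t₀ + 1 ≤ t₃ := h₁.le.trans (h₂.le.trans h₃.le)
  have hsigned : ∀ t, t₃ ≤ t → O ∈ (R.state t).signed := by
    intro t ht
    refine (R.grows (hstart.trans ht)).signed ?_
    rw [FastPay.Run.state_of_sign hO]
    exact Set.mem_insert _ _
  have huniq : ∀ t, t₃ ≤ t → ∀ O' ∈ (R.state t).signed, O'.sender = x →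
      O'.sequence = O.sequence → O' = O := fun t ht O' h1 h2 h3 =>
    hx.signed_unique t h1 (hsigned t ht) h2 hsender h3
  -- If the counter passes the number of `O`, a certificate of `O` was confirmed, and no answer
  -- precedes this because none is ever given.
  by_cases hconf : ∃ t, t₃ ≤ t ∧ O.sequence < (R.state t).nextSequence α x
  · obtain ⟨t, ht, hlt⟩ := hconf
    obtain ⟨C, hC, hseq⟩ := (R.wellFormed t).exists_confirmed hα hlt
    obtain ⟨hvalid, hCx⟩ := (R.wellFormed t).confirmed α x hα C hC
    exact ⟨t, hrep t, C, hC,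
      huniq t ht _ ((R.wellFormed t).signed_of_valid hvalid) hCx hseq⟩
  exfalso
  push Not at hconf
  have hnext : ∀ t, t₃ ≤ t → (R.state t).nextSequence α x = O.sequence := fun t ht =>
    le_antisymm (hconf t ht) (h₃.le_nextSequence.trans ((R.grows ht).nextSequence α x))
  obtain ⟨G, hmono, hG, hcross⟩ := R.exists_credits α x
  have hvalid : ∀ t, t₀ ≤ t → ∀ C ∈ received, (R.state t).Valid sys C := fun t ht C hC =>
    (hreceived C hC).1.mono (R.grows ht).votes
  have hlt := h₂.sequence_lt (hvalid t₁ (by have := h₁.le; omega))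
  have hev : ∀ᶠ t in Filter.atTop, ∀ C ∈ received, C.value ∈ G t :=
    (Filter.eventually_all_finite (List.finite_toSet received)).2 fun C hC =>
      hfair.eventually_mem_credits hα hmono hG hcross
        (hvalid t₂ (by have := h₁.le; have := h₂.le; omega) C hC) (hreceived C hC).2 (hlt C hC)
  obtain ⟨T, hT⟩ := Filter.eventually_atTop.1 hev
  -- Without a reply nothing is ever received, so the user never stops sending `O`; a copy sent
  -- after both `T` and `t₃` is the one that gets accepted.
  have hnot : ∀ t, (x, α, O) ∉ (R.state t).obtained := by
    intro t ht
    obtain ⟨u, hu⟩ := FastPay.Run.exists_mem_replies_of_mem_obtained ht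
    exact hrep u hu
  obtain ⟨v, hv, hsend⟩ := h₄ (max T t₃) (le_max_right _ _) (hnot _)
  obtain ⟨w, hw, hdel⟩ := hfair.request v x α _ hα hsend
  have hTw : T ≤ w := (le_max_left T t₃).trans (hv.trans hw.le)
  have htw : t₃ ≤ w := (le_max_right T t₃).trans (hv.trans hw.le)
  refine hrep (w + 1) (FastPay.Run.mem_replies_of_deliver hdel (hsigned w htw)
    (FastPay.AuthorityState.exists_handleTransfer hamount ?_ ?_ ?_))
  -- A pending order has been voted for by the honest `α`, hence was signed by the user; its number
  -- is the current one, so it is `O`.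
  · intro O' hO'
    rw [hsender] at hO'
    obtain ⟨h1, h2, h3⟩ := (R.wellFormed w).pending α x O' hα hO'
    exact huniq w htw O' ((R.wellFormed w).signed_of_vote α O' hα h3) h1
      (h2.trans (hnext w htw))
  · rw [hsender]
    exact hnext w htw
  · rw [hsender]
    have hbal := (hG w).balance
    have hspent := hx.sum_confirmed_le hO hsender hα (by omega : t₀ ≤ w) (hnext w htw)
    have hgain := FastPay.finsum_amount_le_sum (hT w hTw)
    -- Both lists are prefixes of the ledger at time `w`, so comparing their lengths is enough.
    have hpre : σ <+: (R.state w).ledger.take ((R.state w).authority α).lastTransaction := by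
      refine List.prefix_of_prefix_length_le (hσ.trans (R.grows (by omega)).ledger)
        (List.take_prefix _ _) ?_
      rw [List.length_take, min_eq_left (hG w).lastTransaction_le]
      exact (h₁.length_le (hσ.trans (R.grows (Nat.le_succ _)).ledger)).trans
        ((R.grows (h₂.le.trans (h₃.le.trans htw))).lastTransaction α)
    have hfund := FastPay.funding_le_of_prefix x hpre
    unfold FastPay.GlobalState.confirmed at hspent
    -- The balance equation `hbal`, the bounds on spending, credits and funding, and the assumption
    -- `hfunds` combine linearly.
    omega
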